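/- **Setting.** All manifolds are smooth ($C^\infty$), Hausdorff, finite-dimensional and without boundary. Let $Q$ and $U_0,\dots,U_{n-1}$ be manifolds, and equip $Q$ with a continuous Riemannian metric. Let $\mathcal U_i\subseteq U_i$ be closed sets, let $F_i:Q\times U_i\to Q$, $L_i:Q\times U_i\to\mathbb R$ $(0\le i\le n-1)$ and $\ell:Q\to\mathbb R$ be $C^1$, and let $\varphi_i:Q\to[0,\infty)$ $(0\le i\le n)$ be locally Lipschitz (Lipschitz in some smooth chart around each point). Fix $q_0\in Q$. A sequence $u=(u_i)_{i=0}^{n-1}$ with $u_i\in\mathcal U_i$ generates states $q_{i}=F_{i-1}(q_{i-1},u_{i-1})$, $1\le i\le n$, and has cost $$J(u)=\ell(q_n)+\sum_{i=0}^{n-1}L_i(q_i,u_i).$$ **Definitions.** For a function $f:M\to\mathbb R\cup\{\infty\}$ on a manifold, $\partial_Ff(q)\subseteq T_q^*M$ is the set of $dg(q)$ with $g:M\to\mathbb R$ of class $C^1$ such that $f-g$ has a local minimum at $q$ (empty if $f(q)=\infty$). The limiting subdifferential $\partial_Lf(q)$ is the set of limits, in $T^*M$, of covectors $p_k\in\partial_Ff(x_k)$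 with $x_k\to q$ and $f(x_k)\to f(q)$. For a closed set $S\subseteq M$ and $s\in S$, let $N^L_S(s)=\partial_L\chi_S(s)$, where $\chi_S=0$ on $S$ and $\chi_S=\infty$ off $S$; the Clarke tangent cone is $T^C_S(s)=\{v\in T_sM:\langle p,v\rangle\le0\ \text{for all } p\in N^L_S(s)\}$. The closed set $S$ is *Clarke regular* if for all $s\in S$, $v\in T^C_S(s)$ and all sequences $s_k\to s$ in $S$ there are $v_k\in T^C_S(s_k)$ with $v_k\to v$ in $TM$. For $\varphi:Q\to[0,\infty)$ with $\varphi(x_0)=0$, the set $\{\varphi=0\}$ is *$\varphi$-regular* at $x_0$ if (a) there are $\Delta>0$ and a neighborhood of $x_0$ such that $\|p\|\ge\Delta$ whenever $x$ lies in that neighborhood, $\varphi(x)>0$ and $p\in\partial_L\varphi(x)$ (where $\|\cdot\|$ is the dual norm of the Riemannian metric); and (b) whenever $x_k\to x_0$ and $p_k\in\partial_L\varphi(x_k)$, some subsequence of $(p_k)$ converges in $T^*Q$ to an element of $\partial_L\varphi(x_0)$. **Theorem.** Let $u$ minimize $J$ among all control sequences with $u_i\in\mathcal U_i$ whose states satisfy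 $\varphi_i(q_i)=0$ for $0\le i\le n$ ($u$ itself being one of these), and let $(q_i)_{i=0}^n$ be the state sequence of $u$. Suppose that the sets $\mathcal U_i$ are Clarke regular and that, for $1\le i\le n$, $\{\varphi_i=0\}$ is $\varphi_i$-regular at $q_i$. Then there are $\lambda_0\in\{0,1\}$, a constant $\kappa>0$, with $\kappa=1$ if $\lambda_0=0$, and covectors $p_i\in T^*_{q_i}Q$ $(0\le i\le n)$ such that 1. $-p_n\in\lambda_0\,d\ell(q_n)+\kappa\,\partial_L\varphi_n(q_n)$; 2. for $1\le i\le n$, $\;-p_{i-1}+D_qF_{i-1}(q_{i-1},u_{i-1})^*p_i\in\lambda_0\,d_qL_{i-1}(q_{i-1},u_{i-1})+\kappa\,\partial_L\varphi_{i-1}(q_{i-1})$; 3. for $1\le i\le n$ and all $v\in T^C_{\mathcal U_{i-1}}(u_{i-1})$, $\;0\le\big\langle\lambda_0\,d_uL_{i-1}(q_{i-1},u_{i-1})-D_uF_{i-1}(q_{i-1},u_{i-1})^*p_i,\;v\big\rangle$; and either $\lambda_0=1$ or $(p_1,\dots,p_n)$ is not identically zero. -/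

import Mathlib

open Set Filter Topology Bundle Manifold
open scoped ContDiff

noncomputable section

namespace DiscretePMP

section Nonsmooth

variable {d : ℕ} {M : Type*} [TopologicalSpace M] [ChartedSpace (EuclideanSpace ℝ (Fin d)) M]

/-- A covector at `q`: an element of the cotangent space `T_q^* M`. -/
abbrev Covector (d : ℕ) {M : Type*} [TopologicalSpace M]
    [ChartedSpace (EuclideanSpace ℝ (Fin d)) M] (q : M) : Type :=
  TangentSpace (𝓡 d) q →L[ℝ] ℝ

/-- Convergence `p_k → p` of covectors `p_k ∈ T_{x_k}^* M` to `p ∈ T_q^* M`, in the topology of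
the cotangent bundle `T^* M = Hom(TM, ℝ)`. -/
def CovectorTendsto [IsManifold (𝓡 d) ∞ M] (x : ℕ → M) (ξ : ∀ k, Covector d (x k)) (q : M)
    (p : Covector d q) : Prop :=
  Tendsto
    (fun k => (⟨x k, ξ k⟩ : TotalSpace (EuclideanSpace ℝ (Fin d) →L[ℝ] ℝ)
      (fun y : M => TangentSpace (𝓡 d) y →L[ℝ] Bundle.Trivial M ℝ y)))
    atTop (𝓝 ⟨q, p⟩)

/-- Convergence `v_k → v` of tangent vectors `v_k ∈ T_{x_k} M` to `v ∈ T_q M`, in the topology of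
the tangent bundle. -/
def VectorTendsto [IsManifold (𝓡 d) ∞ M] (x : ℕ → M) (w : ∀ k, TangentSpace (𝓡 d) (x k)) (q : M)
    (v : TangentSpace (𝓡 d) q) : Prop :=
  Tendsto (fun k => (⟨x k, w k⟩ : TangentBundle (𝓡 d) M)) atTop (𝓝 ⟨q, v⟩)

/-- `f : M → ℝ` is locally Lipschitz: around every point there is a smooth coordinate chart in
which `f` is Lipschitz. -/
def LocLipschitz (d : ℕ) {M : Type*} [TopologicalSpace M]
    [ChartedSpace (EuclideanSpace ℝ (Fin d)) M] (f : M → ℝ) : Prop :=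
  ∀ q : M, ∃ e ∈ IsManifold.maximalAtlas (𝓡 d) ∞ M, q ∈ e.source ∧
    ∃ K : NNReal, LipschitzOnWith K (f ∘ e.symm) e.target

/-- The Fréchet subdifferential of an extended-valued function at `q` (empty where `f = ∞`): all
`dg(q)` with `g : M → ℝ` of class `C¹` such that `f - g` has a local minimum at `q`. -/
def frechetSubdiff (f : M → EReal) (q : M) : Set (Covector d q) :=
  {p | f q ≠ ⊤ ∧ ∃ g : M → ℝ, ContMDiff (𝓡 d) 𝓘(ℝ, ℝ) 1 g ∧ mvfderiv (𝓡 d) g q = p ∧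
    IsLocalMin (fun x => f x - (g x : EReal)) q}

/-- The limiting subdifferential: limits of Fréchet subgradients `ξ_k` at points `x_k → q` with
`f(x_k) → f(q)`. -/
def limitingSubdiff [IsManifold (𝓡 d) ∞ M] (f : M → EReal) (q : M) : Set (Covector d q) :=
  {p | ∃ (x : ℕ → M) (ξ : ∀ k, Covector d (x k)),
    Tendsto x atTop (𝓝 q) ∧ (∀ k, ξ k ∈ frechetSubdiff f (x k)) ∧
    Tendsto (fun k => f (x k)) atTop (𝓝 (f q)) ∧ CovectorTendsto x ξ q p}

/-- The limiting subdifferential of a real-valued function. -/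
abbrev limitingSubdiffReal [IsManifold (𝓡 d) ∞ M] (f : M → ℝ) (q : M) : Set (Covector d q) :=
  limitingSubdiff (fun x => (f x : EReal)) q

open Classical in
/-- The function equal to `0` on `S` and to `∞` off `S`. -/
def indicatorFn (S : Set M) (x : M) : EReal := if x ∈ S then 0 else ⊤

/-- The limiting normal cone to `S` at `s ∈ S`. -/
def limitingNormalCone [IsManifold (𝓡 d) ∞ M] (S : Set M) (s : M) : Set (Covector d s) :=
  limitingSubdiff (indicatorFn S) s

/-- The Clarke tangent cone to `S` at `s ∈ S`, the polar of the limiting normal cone. -/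
def clarkeTangentCone [IsManifold (𝓡 d) ∞ M] (S : Set M) (s : M) :
    Set (TangentSpace (𝓡 d) s) :=
  {v | ∀ p ∈ limitingNormalCone (d := d) S s, p v ≤ 0}

/-- Clarke regularity of a closed set: every Clarke tangent vector at `s ∈ S` is a limit of Clarke
tangent vectors along every sequence of points of `S` converging to `s`. -/
def ClarkeRegular (d : ℕ) {M : Type*} [TopologicalSpace M]
    [ChartedSpace (EuclideanSpace ℝ (Fin d)) M] [IsManifold (𝓡 d) ∞ M] (S : Set M) : Prop :=
  IsClosed S ∧ ∀ s ∈ S, ∀ v ∈ clarkeTangentCone (d := d) S s,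
    ∀ x : ℕ → M, (∀ k, x k ∈ S) → Tendsto x atTop (𝓝 s) →
      ∃ w : ∀ k, TangentSpace (𝓡 d) (x k),
        (∀ k, w k ∈ clarkeTangentCone (d := d) S (x k)) ∧ VectorTendsto x w s v

/-- `{φ = 0}` is `φ`-regular at `x₀`. The norm `‖p‖` of a covector is dual to the norm which the
Riemannian metric puts on the tangent space. -/
def PhiRegularAt [IsManifold (𝓡 d) ∞ M]
    [RiemannianBundle (fun x : M => TangentSpace (𝓡 d) x)] (φ : M → ℝ) (x₀ : M) : Prop :=
  φ x₀ = 0 ∧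
  (∃ Δ : ℝ, 0 < Δ ∧ ∀ᶠ x in 𝓝 x₀, 0 < φ x →
    ∀ p ∈ limitingSubdiffReal (d := d) φ x, Δ ≤ ‖p‖) ∧
  (∀ (x : ℕ → M) (ξ : ∀ k, Covector d (x k)), Tendsto x atTop (𝓝 x₀) →
    (∀ k, ξ k ∈ limitingSubdiffReal (d := d) φ (x k)) →
    ∃ p ∈ limitingSubdiffReal (d := d) φ x₀, ∃ s : ℕ → ℕ, StrictMono s ∧
      CovectorTendsto (fun k => x (s k)) (fun k => ξ (s k)) x₀ p)

end Nonsmooth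

section Control

variable {n : ℕ} {Q : Type*} {U : Fin n → Type*}

/-- The state sequence `q_0, …, q_n` with `q_{i+1} = F_i(q_i, u_i)`. -/
def stateSeq (F : ∀ i, Q × U i → Q) (q₀ : Q) (u : ∀ i, U i) : Fin (n + 1) → Q :=
  Fin.induction (motive := fun _ => Q) q₀ (fun i q => F i (q, u i))

/-- The cost `J(u) = ℓ(q_n) + ∑_{i < n} L_i(q_i, u_i)`. -/
def cost (F : ∀ i, Q × U i → Q) (q₀ : Q) (ℓ : Q → ℝ) (L : ∀ i, Q × U i → ℝ)
    (u : ∀ i, U i) : ℝ :=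
  ℓ (stateSeq F q₀ u (Fin.last n)) + ∑ i : Fin n, L i (stateSeq F q₀ u i.castSucc, u i)

/-- The control sequences `u` with `u_i ∈ 𝒰_i` whose states satisfy `φ_i(q_i) = 0`, `0 ≤ i ≤ n`. -/
def feasible (F : ∀ i, Q × U i → Q) (q₀ : Q) (C : ∀ i, Set (U i)) (φ : Fin (n + 1) → Q → ℝ) :
    Set (∀ i, U i) :=
  {u | (∀ i, u i ∈ C i) ∧ ∀ i, φ i (stateSeq F q₀ u i) = 0}

end Control

end DiscretePMP

end

open DiscretePMP

/-! The states are `C¹` functions of the controls, so in charts around the optimal controls the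
problem is to minimize a `C¹` cost over a product `D` of closed pieces, subject to `ψ_j (y_j w) = 0`
with `ψ_j` Lipschitz and nonnegative. The point `q₀` is fixed, so `φ_0` imposes nothing.

The constraints are penalized: minimize `J w + sq (w - w₀) + N * ∑ ψ_j (y_j w)` near `w₀`, where
`sq` makes the minimum strict (`exact_or_infeasible_minimizers`). If `w₀` is a local minimizer for
some `N`, the multiplier of the cost is `1` and `κ = N`. Otherwise, for arbitrarily large `N`, there
are minimizers near `w₀` violating a constraint; after division by `N` the cost disappears, leaving
multiplier `0` and `κ = 1`.

At a minimizer, `exists_fuzzy_fermat` separates the nonsmooth terms: `ψ_j (y_j w)` becomes `ψ_j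
(z_j)` plus a quadratic penalty on `z_j - y_j w`. Minimality in `z_j` gives a Fréchet subgradient of
`ψ_j`, minimality in `w` a Fréchet normal to `D`. The Lipschitz bounds allow passing to limits
(`exists_limiting_multipliers`), and the limits are limiting subgradients and normals on the
manifolds.

The covectors `p_i` solve the adjoint recursion backwards from `p_n`. Pairing them with state
variations and telescoping (`exists_adjoint`) turns the normality relation into the inequality on
each Clarke tangent cone, the polar of the normals.

Nontriviality: if the cost multiplier and `p_1, …, p_n` all vanish, so do the limiting subgradients
of `φ_1, …, φ_n`. But the approximating subgradients include, at every stage, one taken where `φ_j >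
0`, and `φ_j`-regularity keeps these away from zero. -/

namespace DiscretePMP

/-! ### Quadratic and exact penalties: localization of minimizers -/

section Penalty

/-- If `x₀` is the strict minimizer of `f` on `X ∩ {θ = 0}`, minimizers of `f + N θ` on the compact
set `X` exist and are close to `x₀` for large `N`. -/
theorem exists_isMinOn_penalized {Y : Type*} [TopologicalSpace Y] {X : Set Y} (hX : IsCompact X)
    {f θ : Y → ℝ} (hf : ContinuousOn f X) (hθ : ContinuousOn θ X) (hθ0 : ∀ x ∈ X, 0 ≤ θ x)
    {x₀ : Y} (hx₀ : x₀ ∈ X) (hθx₀ : θ x₀ = 0)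
    (hmin : ∀ x ∈ X, θ x = 0 → x ≠ x₀ → f x₀ < f x) {V : Set Y} (hV : V ∈ 𝓝 x₀) :
    ∃ N₀ : ℝ, ∀ N ≥ N₀, ∃ x ∈ X ∩ V, IsMinOn (fun y => f y + N * θ y) X x := by
  obtain ⟨O, hOV, hO, hxO⟩ := mem_nhds_iff.1 hV
  -- Off `O` the penalized value exceeds `f x₀` for all large `N`. The property passes to subsets
  -- and finite unions, so by compactness it need only be checked locally.
  have key : ∃ N₀ : ℝ, ∀ N ≥ N₀, ∀ x ∈ X \ O, f x₀ < f x + N * θ x := by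
    refine (hX.diff hO).induction_on (p := fun s => ∃ N₀ : ℝ, ∀ N ≥ N₀, ∀ x ∈ s,
      f x₀ < f x + N * θ x) ⟨0, by simp⟩ ?_ ?_ ?_
    · rintro s t hst ⟨N, h⟩
      exact ⟨N, fun M hM x hx => h M hM x (hst hx)⟩
    · rintro s t ⟨N, h⟩ ⟨N', h'⟩
      refine ⟨max N N', fun M hM x hx => ?_⟩
      rcases hx with hx | hx
      · exact h M ((le_max_left _ _).trans hM) x hx
      · exact h' M ((le_max_right _ _).trans hM) x hx
    · rintro x ⟨hxX, hxO'⟩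
      have hfx := (hf x hxX).mono (sdiff_subset (t := O))
      have hθx := (hθ x hxX).mono (sdiff_subset (t := O))
      rcases (hθ0 x hxX).eq_or_lt with h0 | h0
      · have hlt : f x₀ < f x := hmin x hxX h0.symm fun h => hxO' (h ▸ hxO)
        refine ⟨{y | f x₀ < f y} ∩ (X \ O), inter_mem (hfx (Ioi_mem_nhds hlt))
          self_mem_nhdsWithin, 0, ?_⟩
        rintro N hN y ⟨hy, hyX⟩
        have := mul_nonneg hN (hθ0 y hyX.1)
        simp only [mem_ofPred_eq] at hy
        linarith
      -- Near `x` one has `f > f x - 1` and `θ > θ x / 2`, so the threshold makes the penalty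
      -- outweigh the possible deficit `f x₀ - f x + 1`.
      · refine ⟨{y | f x - 1 < f y} ∩ {y | θ x / 2 < θ y}, inter_mem
          (hfx (Ioi_mem_nhds (by linarith))) (hθx (Ioi_mem_nhds (by linarith))),
          |f x₀ - f x + 1| / (θ x / 2), ?_⟩
        rintro N hN y ⟨hy, hy'⟩
        simp only [mem_ofPred_eq] at hy hy'
        have h1 : |f x₀ - f x + 1| ≤ N * (θ x / 2) := (div_le_iff₀ (by linarith)).1 hN
        have h2 : 0 ≤ N := le_trans (by positivity) hN
        have h3 := mul_le_mul_of_nonneg_left hy'.le h2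
        have h4 := le_abs_self (f x₀ - f x + 1)
        linarith
  obtain ⟨N₀, h⟩ := key
  refine ⟨N₀, fun N hN => ?_⟩
  obtain ⟨x, hxX, hx⟩ := hX.exists_isMinOn ⟨x₀, hx₀⟩ (hf.add (hθ.const_smul N))
  refine ⟨x, ⟨hxX, hOV ?_⟩, hx⟩
  by_contra hxO'
  have h1 := h N hN x ⟨hxX, hxO'⟩
  have h2 : f x + N * θ x ≤ f x₀ + N * θ x₀ := hx hx₀
  rw [hθx₀] at h2
  linarith

end Penalty

/-! ### Fréchet subgradients and normals in normed spaces -/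

section FlatSubgradients

variable {E : Type*} [NormedAddCommGroup E] [NormedSpace ℝ E]

/-- Fréchet subgradients of a real function on a normed space, with locally `C¹` test functions. -/
def flatSubdiff (f : E → ℝ) (x : E) : Set (E →L[ℝ] ℝ) :=
  {p | ∃ g : E → ℝ, ContDiffAt ℝ 1 g x ∧ fderiv ℝ g x = p ∧ IsLocalMin (fun y => f y - g y) x}

/-- Fréchet normals to a set in a normed space, with locally `C¹` test functions. -/
def flatNormal (D : Set E) (x : E) : Set (E →L[ℝ] ℝ) :=
  {p | ∃ g : E → ℝ, ContDiffAt ℝ 1 g x ∧ fderiv ℝ g x = p ∧ IsLocalMaxOn g D x}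

theorem smul_mem_flatNormal {D : Set E} {x : E} {p : E →L[ℝ] ℝ} (hp : p ∈ flatNormal D x)
    {c : ℝ} (hc : 0 ≤ c) : c • p ∈ flatNormal D x := by
  obtain ⟨g, hg, rfl, hmax⟩ := hp
  refine ⟨fun y => c * g y, contDiffAt_const.mul hg, ?_, ?_⟩
  · exact fderiv_const_mul (hg.differentiableAt one_ne_zero) c
  · filter_upwards [hmax] with y hy
    exact mul_le_mul_of_nonneg_left hy hc

/-- Along a ray the difference quotients of the test function are at most those of `f`, hence at
most `K * ‖v‖`; apply this to `v` and `-v`. This bound gives compactness of the subgradients. -/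
theorem norm_le_of_mem_flatSubdiff {f : E → ℝ} {x : E} {p : E →L[ℝ] ℝ} (hp : p ∈ flatSubdiff f x)
    {K : NNReal} {s : Set E} (hs : s ∈ 𝓝 x) (hf : LipschitzOnWith K f s) : ‖p‖ ≤ K := by
  obtain ⟨g, hg, rfl, hmin⟩ := hp
  have hd := (hg.differentiableAt one_ne_zero).hasFDerivAt
  have hle : ∀ v : E, fderiv ℝ g x v ≤ K * ‖v‖ := by
    intro v
    have hline : HasDerivAt (fun t : ℝ => g (x + t • v)) (fderiv ℝ g x v) 0 := by
      have h1 : HasDerivAt (fun t : ℝ => x + t • v) v 0 := by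
        simpa using ((hasDerivAt_id (0 : ℝ)).smul_const v).const_add x
      have h2 : HasFDerivAt g (fderiv ℝ g x) (x + (0 : ℝ) • v) := by simpa using hd
      exact h2.comp_hasDerivAt 0 h1
    have ht : Tendsto (fun t : ℝ => x + t • v) (𝓝[>] 0) (𝓝 x) := by
      have : Continuous fun t : ℝ => x + t • v := by fun_prop
      simpa using (this.tendsto 0).mono_left nhdsWithin_le_nhds
    refine le_of_tendsto hline.tendsto_slope_zero_right ?_
    filter_upwards [ht.eventually hmin, ht.eventually hs, self_mem_nhdsWithin] with t h1 h2 h3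
    have h3' : (0 : ℝ) < t := h3
    have h4 := hf.dist_le_mul _ h2 _ (mem_of_mem_nhds hs)
    rw [Real.dist_eq, dist_eq_norm, add_sub_cancel_left, norm_smul, Real.norm_eq_abs,
      abs_of_pos h3'] at h4
    have h5 := le_abs_self (f (x + t • v) - f x)
    simp only [zero_add, zero_smul, add_zero, smul_eq_mul]
    rw [inv_mul_le_iff₀ h3']
    linarith
  refine ContinuousLinearMap.opNorm_le_bound _ K.2 fun v => ?_
  rw [Real.norm_eq_abs, abs_le]
  have h1 := hle (-v)
  rw [map_neg, norm_neg] at h1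
  exact ⟨by simpa using neg_le.1 h1, hle v⟩

end FlatSubgradients

/-! ### Fuzzy Fermat rule by decoupling -/

section Fermat

variable {ι W G : Type*} [Fintype ι] [NormedAddCommGroup W] [NormedSpace ℝ W]
  [NormedAddCommGroup G] [InnerProductSpace ℝ G] [FiniteDimensional ℝ G]

theorem fderiv_eq_zero_of_pos {sq : W → ℝ} (hsq0 : sq 0 = 0)
    (hpos : ∀ w, w ≠ 0 → 0 < sq w) : fderiv ℝ sq 0 = 0 := by
  refine IsLocalMin.fderiv_eq_zero (Eventually.of_forall fun w => ?_)
  rcases eq_or_ne w 0 with rfl | h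
  · exact le_rfl
  · exact hsq0 ▸ (hpos w h).le

/-- Fuzzy Fermat rule: near a local minimizer on `D` of `H + κ ∑ ψ_j ∘ y_j` there are Fréchet
subgradients of the `ψ_j` and a Fréchet normal to `D` which almost cancel. -/
theorem exists_fuzzy_fermat {D : Set W} {w₀ : W} {H : W → ℝ} {y : ι → W → G} {ψ : ι → G → ℝ}
    {sq : W → ℝ} (hsq : ContDiff ℝ 1 sq) (hsq0 : sq 0 = 0) (hpos : ∀ w, w ≠ 0 → 0 < sq w)
    {κ : ℝ} (hκ : 0 < κ) (hw₀ : w₀ ∈ D)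
    (hD : ∃ r > 0, IsCompact (D ∩ Metric.closedBall w₀ r))
    (hH : ContDiffAt ℝ 1 H w₀) (hy : ∀ j, ContDiffAt ℝ 1 (y j) w₀)
    (hψ : ∀ j, ∀ᶠ z in 𝓝 (y j w₀), ContinuousAt (ψ j) z)
    (hmin : IsLocalMinOn (fun w => H w + κ * ∑ j, ψ j (y j w)) D w₀)
    {A : Set W} (hA : A ∈ 𝓝 w₀) {B : ι → Set G} (hB : ∀ j, B j ∈ 𝓝 (y j w₀))
    {η : ℝ} (hη : 0 < η) :
    ∃ w ∈ D ∩ A, ∃ z : ι → G, ∃ b : ι → G →L[ℝ] ℝ, ∃ ν ∈ flatNormal D w,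
      (∀ j, z j ∈ B j ∧ b j ∈ flatSubdiff (ψ j) (z j)) ∧
      ‖ν + (fderiv ℝ H w + κ • ∑ j, (b j).comp (fderiv ℝ (y j) w))‖ < η := by
  obtain ⟨r₀, hr₀, hcomp⟩ := hD
  have hsqc : Continuous fun w => ‖fderiv ℝ (fun v => sq (v - w₀)) w‖ := by
    have : ContDiff ℝ 1 fun v => sq (v - w₀) := hsq.comp (contDiff_id.sub contDiff_const)
    exact (this.continuous_fderiv one_ne_zero).norm
  have hsqs : ∀ᶠ w in 𝓝 w₀, ‖fderiv ℝ (fun v => sq (v - w₀)) w‖ < η := by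
    refine hsqc.continuousAt.eventually_lt continuousAt_const ?_
    rw [fderiv_comp_sub, sub_self, fderiv_eq_zero_of_pos hsq0 hpos, norm_zero]
    exact hη
  have hev : ∀ᶠ w in 𝓝 w₀, (w ∈ A ∧ ContDiffAt ℝ 1 H w ∧ (∀ j, ContDiffAt ℝ 1 (y j) w) ∧
      ‖fderiv ℝ (fun v => sq (v - w₀)) w‖ < η) ∧
      (w ∈ D → H w₀ + κ * ∑ j, ψ j (y j w₀) ≤ H w + κ * ∑ j, ψ j (y j w)) := by
    refine Filter.Eventually.and ?_ (eventually_nhdsWithin_iff.1 hmin)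
    have h1 := hH.eventually (by simp)
    have h2 : ∀ᶠ w in 𝓝 w₀, ∀ j, ContDiffAt ℝ 1 (y j) w :=
      eventually_all.2 fun j => (hy j).eventually (by simp)
    filter_upwards [hA, h1, h2, hsqs] with w a b c d using ⟨a, b, c, d⟩
  obtain ⟨r₁, hr₁, hball⟩ := Metric.eventually_nhds_iff_ball.1 hev
  have hev' : ∀ᶠ s : ℝ in 𝓝[>] 0, ∀ j, ∀ z ∈ Metric.closedBall (y j w₀) s,
      z ∈ B j ∧ ContinuousAt (ψ j) z := by
    refine eventually_all.2 fun j => ?_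
    obtain ⟨s, hs, hs'⟩ := Metric.eventually_nhds_iff_ball.1
      (Filter.Eventually.and (hB j) (hψ j))
    filter_upwards [Ioo_mem_nhdsGT hs] with t ht z hz
    exact hs' z (Metric.closedBall_subset_ball ht.2 hz)
  obtain ⟨s, hs, hs0⟩ := (hev'.and self_mem_nhdsWithin).exists
  have hs0 : 0 < s := hs0
  set r := min r₀ (r₁ / 2) with hr
  have hr0 : 0 < r := lt_min hr₀ (by linarith)
  have hrr₁ : Metric.closedBall w₀ r ⊆ Metric.ball w₀ r₁ :=
    Metric.closedBall_subset_ball ((min_le_right _ _).trans_lt (by linarith))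
  set X : Set (W × (ι → G)) := (D ∩ Metric.closedBall w₀ r) ×ˢ
    (univ.pi fun j => Metric.closedBall (y j w₀) s) with hXdef
  have hX : IsCompact X := by
    refine IsCompact.prod ?_ (isCompact_univ_pi fun j => isCompact_closedBall _ _)
    have : D ∩ Metric.closedBall w₀ r =
        (D ∩ Metric.closedBall w₀ r₀) ∩ Metric.closedBall w₀ r := by
      rw [inter_assoc, inter_eq_right.2 (Metric.closedBall_subset_closedBall (min_le_left _ _))]
    rw [this]
    exact hcomp.inter_right Metric.isClosed_closedBall
  -- Decoupling: `z_j` replaces `y_j w` inside `ψ_j`, and `θ` penalizes the mismatch. On `θ = 0` the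
  -- original problem returns, with strict minimizer `w₀` thanks to `sq`.
  set f : W × (ι → G) → ℝ := fun x => H x.1 + κ * ∑ j, ψ j (x.2 j) + sq (x.1 - w₀) with hf
  set θ : W × (ι → G) → ℝ := fun x => ∑ j, ‖x.2 j - y j x.1‖ ^ 2 with hθ
  have hXball : ∀ x ∈ X, x.1 ∈ Metric.ball w₀ r₁ := fun x hx => hrr₁ hx.1.2
  have hyc : ∀ j, ContinuousOn (fun x : W × (ι → G) => y j x.1) X := fun j x hx =>
    (ContinuousAt.comp (f := Prod.fst) ((hball x.1 (hXball x hx)).1.2.2.1 j).continuousAt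
      continuousAt_fst).continuousWithinAt
  have hψc : ∀ j, ContinuousOn (fun x : W × (ι → G) => ψ j (x.2 j)) X := fun j x hx =>
    (ContinuousAt.comp (f := fun x : W × (ι → G) => x.2 j) (hs j _ (hx.2 j trivial)).2
      (by fun_prop)).continuousWithinAt
  have hHc : ContinuousOn (fun x : W × (ι → G) => H x.1) X := fun x hx =>
    (ContinuousAt.comp (f := Prod.fst) (hball x.1 (hXball x hx)).1.2.1.continuousAt
      continuousAt_fst).continuousWithinAt
  have hfc : ContinuousOn f X := by
    refine (hHc.add (continuousOn_const.mul (continuousOn_finsetSum _ fun j _ => hψc j))).add ?_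
    exact (hsq.continuous.comp (continuous_fst.sub continuous_const)).continuousOn
  have hθc : ContinuousOn θ X := by
    refine continuousOn_finsetSum _ fun j _ => ContinuousOn.pow (ContinuousOn.norm ?_) 2
    exact ContinuousOn.sub (by fun_prop) (hyc j)
  set x₀ : W × (ι → G) := (w₀, fun j => y j w₀) with hx₀
  have hx₀X : x₀ ∈ X := ⟨⟨hw₀, Metric.mem_closedBall_self hr0.le⟩, fun j _ =>
    Metric.mem_closedBall_self hs0.le⟩
  have hstrict : ∀ x ∈ X, θ x = 0 → x ≠ x₀ → f x₀ < f x := by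
    intro x hx hθx hne
    have hz : ∀ j, x.2 j = y j x.1 := by
      intro j
      have := (Finset.sum_eq_zero_iff_of_nonneg fun j _ => by positivity).1 hθx j
        (Finset.mem_univ j)
      exact sub_eq_zero.1 (norm_eq_zero.1 (pow_eq_zero_iff two_ne_zero |>.1 this))
    have hne' : x.1 - w₀ ≠ 0 := by
      intro h
      have h1 := sub_eq_zero.1 h
      exact hne (Prod.ext h1 (funext fun j => by rw [hz j, h1]))
    have h1 := (hball x.1 (hXball x hx)).2 hx.1.1
    have h2 := hpos _ hne'
    simp only [hf, hx₀, hz, sub_self, hsq0]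
    linarith
  have hVnhds : (Metric.ball w₀ r) ×ˢ (univ.pi fun j => Metric.ball (y j w₀) s) ∈ 𝓝 x₀ :=
    prod_mem_nhds (Metric.ball_mem_nhds _ hr0)
      (set_pi_mem_nhds finite_univ fun j _ => Metric.ball_mem_nhds _ hs0)
  obtain ⟨N₀, hN₀⟩ := exists_isMinOn_penalized hX hfc hθc
    (fun x _ => Finset.sum_nonneg fun j _ => by positivity) hx₀X (by simp [hθ, hx₀]) hstrict hVnhds
  obtain ⟨N, hN, hNpos⟩ : ∃ N, N₀ ≤ N ∧ 0 < N := ⟨max N₀ 1, le_max_left _ _, by positivity⟩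
  obtain ⟨⟨w, z⟩, ⟨hwzX, hwzV⟩, hwz⟩ := hN₀ N hN
  obtain ⟨⟨hwA, hHw, hyw, hsqw⟩, -⟩ := hball w (hXball _ hwzX)
  have hd : ∀ j, HasFDerivAt (fun v => ‖z j - y j v‖ ^ 2)
      (-(2 : ℝ) • (innerSL ℝ (z j - y j w)).comp (fderiv ℝ (y j) w)) w := by
    intro j
    have h1 : HasFDerivAt (fun v => z j - y j v) (-fderiv ℝ (y j) w) w :=
      ((hyw j).differentiableAt one_ne_zero).hasFDerivAt.const_sub _
    convert h1.norm_sq using 1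
    ext v
    simp
    ring
  have hdz : ∀ j, HasFDerivAt (fun v => ‖v - y j w‖ ^ 2) ((2 : ℝ) • innerSL ℝ (z j - y j w))
      (z j) := by
    intro j
    have h1 : HasFDerivAt (fun v => v - y j w) (ContinuousLinearMap.id ℝ G) (z j) :=
      (hasFDerivAt_id (z j)).sub_const (y j w)
    simpa [two_smul] using h1.norm_sq
  have hg : ContDiffAt ℝ 1 (fun v => -(H v + sq (v - w₀) + N * ∑ j, ‖z j - y j v‖ ^ 2)) w := by
    refine ((hHw.add ?_).add (contDiffAt_const.mul (ContDiffAt.sum fun j _ => ?_))).neg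
    · exact (hsq.comp (contDiff_id.sub contDiff_const)).contDiffAt
    · exact (contDiffAt_const.sub (hyw j)).norm_sq ℝ
  -- The subgradient comes from stationarity of `κ ψ_j (z_j) + N ‖z_j - y_j w‖²` in `z_j`. The
  -- normal is minus the derivative of the part smooth in `w`. In the sum the mismatch terms cancel
  -- and only the small derivative of `sq` remains.
  refine ⟨w, ⟨hwzX.1.1, hwA⟩, z, fun j => (-(2 * N / κ)) • innerSL ℝ (z j - y j w), _,
    ⟨fun v => -(H v + sq (v - w₀) + N * ∑ j, ‖z j - y j v‖ ^ 2), hg, rfl, ?_⟩, fun j => ⟨?_, ?_⟩, ?_⟩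
  · have : ∀ᶠ v in 𝓝[D] w, v ∈ D ∩ Metric.ball w₀ r :=
      inter_mem self_mem_nhdsWithin (nhdsWithin_le_nhds (Metric.isOpen_ball.mem_nhds hwzV.1))
    filter_upwards [this] with v hv
    have h := hwz (show (v, z) ∈ X from
      ⟨⟨hv.1, Metric.ball_subset_closedBall hv.2⟩, hwzX.2⟩)
    simp only [hf, hθ, mem_ofPred_eq] at h
    linarith
  · exact (hs j _ (hwzX.2 j trivial)).1
  · refine ⟨fun v => -(N / κ) * ‖v - y j w‖ ^ 2, ?_, ?_, ?_⟩
    · exact contDiffAt_const.mul ((contDiffAt_id.sub contDiffAt_const).norm_sq ℝ)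
    · rw [((hdz j).const_mul _).fderiv, smul_smul]
      congr 1
      ring
    · have : ∀ᶠ v in 𝓝 (z j), v ∈ Metric.ball (y j w₀) s :=
        Metric.isOpen_ball.mem_nhds (hwzV.2 j trivial)
      classical
      filter_upwards [this] with v hv
      -- Only the `j`-th variable moves, so all other summands of `f` and `θ` cancel.
      have h := hwz (show (w, Function.update z j v) ∈ X from ⟨hwzX.1, fun i _ => by
        rcases eq_or_ne i j with rfl | hij
        · simpa using Metric.ball_subset_closedBall hv
        · simpa [hij] using hwzX.2 i trivial⟩)
      have e1 : ∑ i, ψ i (Function.update z j v i) - ∑ i, ψ i (z i) = ψ j v - ψ j (z j) := by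
        rw [← Finset.sum_sub_distrib, Finset.sum_eq_single j]
        · simp
        · intro i _ hij; simp [hij]
        · simp
      have e2 : ∑ i, ‖Function.update z j v i - y i w‖ ^ 2 - ∑ i, ‖z i - y i w‖ ^ 2 =
          ‖v - y j w‖ ^ 2 - ‖z j - y j w‖ ^ 2 := by
        rw [← Finset.sum_sub_distrib, Finset.sum_eq_single j]
        · simp
        · intro i _ hij; simp [hij]
        · simp
      simp only [hf, hθ, mem_ofPred_eq] at h
      have h2 : κ * (ψ j v - ψ j (z j)) + N * (‖v - y j w‖ ^ 2 - ‖z j - y j w‖ ^ 2) ≥ 0 := by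
        rw [← e1, ← e2]; linarith
      have h3 : κ * ((ψ j v - -(N / κ) * ‖v - y j w‖ ^ 2) -
          (ψ j (z j) - -(N / κ) * ‖z j - y j w‖ ^ 2)) ≥ 0 := by
        have : κ * (N / κ) = N := by field_simp
        calc _ = κ * (ψ j v - ψ j (z j)) + κ * (N / κ) * (‖v - y j w‖ ^ 2 - ‖z j - y j w‖ ^ 2) := by
              ring
          _ ≥ 0 := by rw [this]; exact h2
      have h4 := nonneg_of_mul_nonneg_right h3 hκ
      linarith
  · have hsqd : HasFDerivAt (fun v => sq (v - w₀)) (fderiv ℝ (fun v => sq (v - w₀)) w) w := by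
      have : ContDiff ℝ 1 fun v => sq (v - w₀) := hsq.comp (contDiff_id.sub contDiff_const)
      exact (this.differentiable one_ne_zero w).hasFDerivAt
    have hsum := HasFDerivAt.fun_sum (u := Finset.univ) fun j _ => hd j
    have := (((hHw.differentiableAt one_ne_zero).hasFDerivAt.fun_add hsqd).fun_add
      (hsum.const_mul N)).fun_neg
    rw [HasFDerivAt.fderiv this]
    refine lt_of_eq_of_lt ?_ hsqw
    rw [← norm_neg]
    congr 1
    have e : κ • ∑ j, ((-(2 * N / κ)) • innerSL ℝ (z j - y j w)).comp (fderiv ℝ (y j) w) =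
        N • ∑ j, -(2 : ℝ) • (innerSL ℝ (z j - y j w)).comp (fderiv ℝ (y j) w) := by
      rw [Finset.smul_sum, Finset.smul_sum]
      refine Finset.sum_congr rfl fun j _ => ?_
      rw [ContinuousLinearMap.smul_comp, smul_smul, smul_smul]
      congr 1
      field_simp
    rw [e]
    abel

end Fermat

/-! ### Multiplier rule: exact and degenerate penalization -/

section Multipliers

variable {ι W G : Type*} [Fintype ι] [NormedAddCommGroup W]

/-- Either some penalization of the constraints `ψ_j (y_j w) = 0` is exact at `w₀`, or there are
infeasible local minimizers of penalized functions, with large penalties, near `w₀`. -/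
theorem exact_or_infeasible_minimizers {D : Set W} {w₀ : W} {J : W → ℝ} {y : ι → W → G}
    {ψ : ι → G → ℝ} {sq : W → ℝ} (hsq : Continuous sq) (hsq0 : sq 0 = 0)
    (hpos : ∀ w, w ≠ 0 → 0 < sq w) (hψ0 : ∀ j z, 0 ≤ ψ j z) (hw₀ : w₀ ∈ D)
    (hfeas : ∀ j, ψ j (y j w₀) = 0)
    (hD : ∃ r > 0, IsCompact (D ∩ Metric.closedBall w₀ r))
    (hJ : ∀ᶠ w in 𝓝 w₀, ContinuousAt J w)
    (hψy : ∀ j, ∀ᶠ w in 𝓝 w₀, ContinuousAt (fun v => ψ j (y j v)) w)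
    (hmin : ∀ᶠ w in 𝓝[D] w₀, (∀ j, ψ j (y j w) = 0) → J w₀ ≤ J w) :
    (∃ N > 0, IsLocalMinOn (fun w => (J w + sq (w - w₀)) + N * ∑ j, ψ j (y j w)) D w₀) ∨
    ∀ V ∈ 𝓝 w₀, ∀ M : ℝ, ∃ N > 0, M ≤ N ∧ ∃ w ∈ D ∩ V, (∃ j, 0 < ψ j (y j w)) ∧
      IsLocalMinOn (fun w => (J w + sq (w - w₀)) + N * ∑ j, ψ j (y j w)) D w := by
  rw [or_iff_not_imp_left]
  intro hno V hV M
  obtain ⟨r₀, hr₀, hcomp⟩ := hD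
  obtain ⟨r₁, hr₁, hball⟩ := Metric.eventually_nhds_iff_ball.1
    ((hJ.and (eventually_all.2 hψy)).and (eventually_nhdsWithin_iff.1 hmin))
  set r := min r₀ (r₁ / 2) with hr
  have hr0 : 0 < r := lt_min hr₀ (by linarith)
  have hrr₁ : Metric.closedBall w₀ r ⊆ Metric.ball w₀ r₁ :=
    Metric.closedBall_subset_ball ((min_le_right _ _).trans_lt (by linarith))
  have hX : IsCompact (D ∩ Metric.closedBall w₀ r) := by
    have : D ∩ Metric.closedBall w₀ r =
        (D ∩ Metric.closedBall w₀ r₀) ∩ Metric.closedBall w₀ r := by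
      rw [inter_assoc, inter_eq_right.2 (Metric.closedBall_subset_closedBall (min_le_left _ _))]
    rw [this]
    exact hcomp.inter_right Metric.isClosed_closedBall
  have hzero : ∀ w, ∑ j, ψ j (y j w) = 0 → ∀ j, ψ j (y j w) = 0 := fun w h j =>
    (Finset.sum_eq_zero_iff_of_nonneg fun j _ => hψ0 j _).1 h j (Finset.mem_univ j)
  obtain ⟨N₀, hN₀⟩ := exists_isMinOn_penalized hX
    (f := fun w => J w + sq (w - w₀)) (θ := fun w => ∑ j, ψ j (y j w)) (x₀ := w₀)
    (fun w hw => ((hball w (hrr₁ hw.2)).1.1.add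
      (hsq.comp (continuous_id.sub continuous_const)).continuousAt).continuousWithinAt)
    (continuousOn_finsetSum _ fun j _ w hw =>
      ((hball w (hrr₁ hw.2)).1.2 j).continuousWithinAt)
    (fun w _ => Finset.sum_nonneg fun j _ => hψ0 j _)
    ⟨hw₀, Metric.mem_closedBall_self hr0.le⟩ (Finset.sum_eq_zero fun j _ => hfeas j)
    (by
      intro w hw hθ hne
      have h1 := (hball w (hrr₁ hw.2)).2 hw.1 (hzero w hθ)
      have h2 := hpos _ (sub_ne_zero.2 hne)
      simp only [sub_self, hsq0]
      linarith)
    (inter_mem hV (Metric.ball_mem_nhds _ hr0))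
  set N := max (max N₀ M) 1 with hN
  have hNpos : 0 < N := lt_of_lt_of_le one_pos (le_max_right _ _)
  obtain ⟨w, ⟨hwX, hwV, hwr⟩, hw⟩ := hN₀ N ((le_max_left _ _).trans (le_max_left _ _))
  have hloc : IsLocalMinOn (fun w => (J w + sq (w - w₀)) + N * ∑ j, ψ j (y j w)) D w := by
    have : ∀ᶠ v in 𝓝[D] w, v ∈ D ∩ Metric.ball w₀ r :=
      inter_mem self_mem_nhdsWithin (nhdsWithin_le_nhds (Metric.isOpen_ball.mem_nhds hwr))
    filter_upwards [this] with v hv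
    exact hw ⟨hv.1, Metric.ball_subset_closedBall hv.2⟩
  refine ⟨N, hNpos, (le_max_right _ _).trans (le_max_left _ _), w, ⟨hwX.1, hwV⟩, ?_, hloc⟩
  -- A feasible minimizer equal to `w₀` would make the penalty `N` exact; any other one has a larger
  -- value than `w₀` because of `sq`.
  by_contra hall
  have hz : ∀ j, ψ j (y j w) = 0 := fun j =>
    le_antisymm (not_lt.1 fun h => hall ⟨j, h⟩) (hψ0 j _)
  rcases eq_or_ne w w₀ with rfl | hne
  · exact hno ⟨N, hNpos, hloc⟩
  · have h1 := (hball w (hrr₁ hwX.2)).2 hwX.1 hz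
    have h2 := hpos _ (sub_ne_zero.2 hne)
    have h3 := hw (show w₀ ∈ D ∩ Metric.closedBall w₀ r from
      ⟨hw₀, Metric.mem_closedBall_self hr0.le⟩)
    simp only [mem_ofPred_eq, hz, hfeas, sub_self, hsq0, Finset.sum_const_zero] at h3
    linarith

variable [NormedSpace ℝ W] [NormedAddCommGroup G] [InnerProductSpace ℝ G] [FiniteDimensional ℝ G]

/-- In the exact case the fuzzy Fermat rule is applied at `w₀` itself. Otherwise it is applied at an
infeasible minimizer and divided by `N`: the derivative of the cost is bounded near `w₀` and becomes
negligible, normals can be rescaled, and a violated constraint stays violated at nearby points. -/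
theorem exists_approx_multipliers {D : Set W} {w₀ : W} {J : W → ℝ} {y : ι → W → G}
    {ψ : ι → G → ℝ} {sq : W → ℝ} (hsq : ContDiff ℝ 1 sq) (hsq0 : sq 0 = 0)
    (hpos : ∀ w, w ≠ 0 → 0 < sq w) (hψ0 : ∀ j z, 0 ≤ ψ j z) (hw₀ : w₀ ∈ D)
    (hfeas : ∀ j, ψ j (y j w₀) = 0)
    (hD : ∃ r > 0, IsCompact (D ∩ Metric.closedBall w₀ r))
    (hJ : ContDiffAt ℝ 1 J w₀) (hy : ∀ j, ContDiffAt ℝ 1 (y j) w₀)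
    (hψ : ∀ j, ∀ᶠ z in 𝓝 (y j w₀), ContinuousAt (ψ j) z)
    (hmin : ∀ᶠ w in 𝓝[D] w₀, (∀ j, ψ j (y j w) = 0) → J w₀ ≤ J w) :
    ∃ lam κ : ℝ, (lam = 0 ∨ lam = 1) ∧ 0 < κ ∧ (lam = 0 → κ = 1) ∧
      ∀ A ∈ 𝓝 w₀, ∀ B : ι → Set G, (∀ j, B j ∈ 𝓝 (y j w₀)) → ∀ η > 0,
      ∃ w ∈ D ∩ A, ∃ z : ι → G, ∃ b : ι → G →L[ℝ] ℝ, ∃ ν ∈ flatNormal D w,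
        (∀ j, z j ∈ B j ∧ b j ∈ flatSubdiff (ψ j) (z j)) ∧
        ‖ν + (lam • fderiv ℝ J w + κ • ∑ j, (b j).comp (fderiv ℝ (y j) w))‖ < η ∧
        (lam = 0 → ∃ j, 0 < ψ j (z j)) := by
  have hJe : ∀ᶠ w in 𝓝 w₀, ContDiffAt ℝ 1 J w := hJ.eventually (by simp)
  have hye : ∀ j, ∀ᶠ w in 𝓝 w₀, ContDiffAt ℝ 1 (y j) w := fun j => (hy j).eventually (by simp)
  have hψe : ∀ j, ∀ᶠ w in 𝓝 w₀, ∀ᶠ z in 𝓝 (y j w), ContinuousAt (ψ j) z := fun j =>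
    (hy j).continuousAt.eventually (eventually_eventually_nhds.2 (hψ j))
  have hsqs : ContDiff ℝ 1 fun w => sq (w - w₀) := hsq.comp (contDiff_id.sub contDiff_const)
  set H : W → ℝ := fun w => J w + sq (w - w₀) with hHdef
  have hH : ContDiffAt ℝ 1 H w₀ := hJ.add hsqs.contDiffAt
  have hHfd : ∀ᶠ w in 𝓝 w₀, fderiv ℝ H w = fderiv ℝ J w + fderiv ℝ (fun w => sq (w - w₀)) w := by
    filter_upwards [hJe] with w hw
    exact fderiv_fun_add (hw.differentiableAt one_ne_zero)
      (hsqs.contDiffAt.differentiableAt one_ne_zero)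
  rcases exact_or_infeasible_minimizers hsq.continuous hsq0 hpos hψ0 hw₀ hfeas hD
    (hJe.mono fun w h => h.continuousAt)
    (fun j => ((hψe j).and (hye j)).mono fun w h =>
      ContinuousAt.comp (g := ψ j) h.1.self_of_nhds h.2.continuousAt) hmin with
    ⟨N, hN, hloc⟩ | hinf
  · refine ⟨1, N, Or.inr rfl, hN, fun h => absurd h one_ne_zero, fun A hA B hB η hη => ?_⟩
    have hsmall : ∀ᶠ w in 𝓝 w₀, ‖fderiv ℝ (fun w => sq (w - w₀)) w‖ < η / 2 := by
      refine (hsqs.continuous_fderiv one_ne_zero).norm.continuousAt.eventually_lt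
        continuousAt_const ?_
      rw [fderiv_comp_sub, sub_self, fderiv_eq_zero_of_pos hsq0 hpos, norm_zero]
      linarith
    obtain ⟨w, ⟨hwD, ⟨hwA, hws⟩, hwH⟩, z, b, ν, hν, hzb, hlt⟩ := exists_fuzzy_fermat hsq hsq0 hpos
      hN hw₀ hD hH hy hψ hloc (inter_mem (inter_mem hA hsmall) hHfd) hB (half_pos hη)
    refine ⟨w, ⟨hwD, hwA⟩, z, b, ν, hν, hzb, ?_, fun h => absurd h one_ne_zero⟩
    simp only [mem_ofPred_eq] at hws hwH
    rw [hwH] at hlt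
    have e : ν + ((1 : ℝ) • fderiv ℝ J w + N • ∑ j, (b j).comp (fderiv ℝ (y j) w)) =
        (ν + (fderiv ℝ J w + fderiv ℝ (fun w => sq (w - w₀)) w +
          N • ∑ j, (b j).comp (fderiv ℝ (y j) w))) - fderiv ℝ (fun w => sq (w - w₀)) w := by
      rw [one_smul]; abel
    rw [e]
    exact (norm_sub_le _ _).trans_lt (by linarith)
  · refine ⟨0, 1, Or.inl rfl, one_pos, fun _ => rfl, fun A hA B hB η hη => ?_⟩
    set M := ‖fderiv ℝ H w₀‖ + 1 with hM
    have hMpos : 0 < M := by positivity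
    have hHb : ∀ᶠ w in 𝓝 w₀, ‖fderiv ℝ H w‖ < M :=
      ((hH.fderiv_right (m := 0) (by simp)).continuousAt.norm).eventually_lt continuousAt_const
        (lt_add_one _)
    obtain ⟨r, hr, hcomp⟩ := hD
    have hgood : ∀ᶠ w in 𝓝 w₀, (A ∩ {w | ‖fderiv ℝ H w‖ < M} ∈ 𝓝 w ∧ ContDiffAt ℝ 1 J w) ∧
        w ∈ Metric.ball w₀ (r / 2) ∧ ∀ j, B j ∈ 𝓝 (y j w) ∧ ContDiffAt ℝ 1 (y j) w ∧
          ∀ᶠ z in 𝓝 (y j w), ContinuousAt (ψ j) z := by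
      refine ((eventually_mem_nhds_iff.2 (inter_mem hA hHb)).and hJe).and
        (Filter.Eventually.and (Metric.ball_mem_nhds _ (half_pos hr)) (eventually_all.2 fun j => ?_))
      exact ((hy j).continuousAt.eventually (eventually_mem_nhds_iff.2 (hB j))).and
        ((hye j).and (hψe j))
    -- The threshold pays for the Fermat error `1` and the bound `M` on `fderiv ℝ H`: after division
    -- by `N` both together are below `η`.
    obtain ⟨N, hN, hNM, w₁, ⟨hw₁D, ⟨hA₁, hJ₁⟩, hr₁, h₁⟩, ⟨j₀, hj₀⟩, hloc⟩ :=
      hinf _ hgood ((1 + M) / η)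
    have hcomp₁ : IsCompact (D ∩ Metric.closedBall w₁ (r / 2)) := by
      have hsub : Metric.closedBall w₁ (r / 2) ⊆ Metric.closedBall w₀ r :=
        Metric.closedBall_subset_closedBall' (by linarith [Metric.mem_ball.1 hr₁])
      have : D ∩ Metric.closedBall w₁ (r / 2) =
          (D ∩ Metric.closedBall w₀ r) ∩ Metric.closedBall w₁ (r / 2) := by
        rw [inter_assoc, inter_eq_right.2 hsub]
      rw [this]
      exact hcomp.inter_right Metric.isClosed_closedBall
    -- The neighbourhoods are shrunk so that a constraint violated at `y j w₁` is also violated at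
    -- `z j`.
    have hB₁ : ∀ j, B j ∩ {z | 0 < ψ j (y j w₁) → 0 < ψ j z} ∈ 𝓝 (y j w₁) := by
      refine fun j => inter_mem (h₁ j).1 ?_
      by_cases h : 0 < ψ j (y j w₁)
      · filter_upwards [(h₁ j).2.2.self_of_nhds.eventually (lt_mem_nhds h)] with z hz _ using hz
      · exact Eventually.of_forall fun z hz => absurd hz h
    obtain ⟨w, ⟨hwD, hwA, hwM⟩, z, b, ν, hν, hzb, hlt⟩ := exists_fuzzy_fermat hsq hsq0 hpos
      hN hw₁D ⟨r / 2, half_pos hr, hcomp₁⟩ (hJ₁.add hsqs.contDiffAt) (fun j => (h₁ j).2.1)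
      (fun j => (h₁ j).2.2) hloc hA₁ hB₁ one_pos
    refine ⟨w, ⟨hwD, hwA⟩, z, b, N⁻¹ • ν, smul_mem_flatNormal hν (by positivity),
      fun j => ⟨(hzb j).1.1, (hzb j).2⟩, ?_, fun _ => ⟨j₀, (hzb j₀).1.2 hj₀⟩⟩
    have e : N⁻¹ • ν + ((0 : ℝ) • fderiv ℝ J w + (1 : ℝ) • ∑ j, (b j).comp (fderiv ℝ (y j) w)) =
        N⁻¹ • ((ν + (fderiv ℝ H w + N • ∑ j, (b j).comp (fderiv ℝ (y j) w))) -
          fderiv ℝ H w) := by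
      rw [zero_smul, zero_add, one_smul, add_sub_assoc, add_sub_cancel_left, smul_add, smul_smul,
        inv_mul_cancel₀ hN.ne', one_smul]
    rw [e, norm_smul, norm_inv, Real.norm_eq_abs, abs_of_pos hN, inv_mul_lt_iff₀ hN]
    have h2 : 1 + M ≤ N * η := (div_le_iff₀ hη).1 hNM
    have h3 : ‖fderiv ℝ H w‖ < M := hwM
    exact (norm_sub_le _ _).trans_lt (by linarith)

/-- Limiting multiplier rule in a normed space. -/
theorem exists_limiting_multipliers {D : Set W} {w₀ : W} {J : W → ℝ} {y : ι → W → G}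
    {ψ : ι → G → ℝ} {sq : W → ℝ} (hsq : ContDiff ℝ 1 sq) (hsq0 : sq 0 = 0)
    (hpos : ∀ w, w ≠ 0 → 0 < sq w) (hψ0 : ∀ j z, 0 ≤ ψ j z) (hw₀ : w₀ ∈ D)
    (hfeas : ∀ j, ψ j (y j w₀) = 0)
    (hD : ∃ r > 0, IsCompact (D ∩ Metric.closedBall w₀ r))
    (hJ : ContDiffAt ℝ 1 J w₀) (hy : ∀ j, ContDiffAt ℝ 1 (y j) w₀)
    (hψ : ∀ j, ∃ K : NNReal, ∃ s ∈ 𝓝 (y j w₀), LipschitzOnWith K (ψ j) s)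
    (hmin : ∀ᶠ w in 𝓝[D] w₀, (∀ j, ψ j (y j w) = 0) → J w₀ ≤ J w) :
    ∃ lam κ : ℝ, (lam = 0 ∨ lam = 1) ∧ 0 < κ ∧ (lam = 0 → κ = 1) ∧
      ∃ (w : ℕ → W) (ν : ℕ → W →L[ℝ] ℝ) (z : ℕ → ι → G) (b : ℕ → ι → G →L[ℝ] ℝ)
        (a : ι → G →L[ℝ] ℝ),
        (∀ k, w k ∈ D ∧ ν k ∈ flatNormal D (w k)) ∧ Tendsto w atTop (𝓝 w₀) ∧
        Tendsto ν atTop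
          (𝓝 (-(lam • fderiv ℝ J w₀ + κ • ∑ j, (a j).comp (fderiv ℝ (y j) w₀)))) ∧
        (∀ j, Tendsto (fun k => z k j) atTop (𝓝 (y j w₀)) ∧
          Tendsto (fun k => b k j) atTop (𝓝 (a j))) ∧
        (∀ k j, b k j ∈ flatSubdiff (ψ j) (z k j)) ∧
        (lam = 0 → ∀ k, ∃ j, 0 < ψ j (z k j)) := by
  choose K s hs hK using hψ
  obtain ⟨lam, κ, hlam, hκ, hlk, happ⟩ := exists_approx_multipliers hsq hsq0 hpos hψ0 hw₀ hfeas hD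
    hJ hy (fun j => (eventually_mem_nhds_iff.2 (hs j)).mono fun z hz =>
      (hK j).continuousOn.continuousAt hz) hmin
  refine ⟨lam, κ, hlam, hκ, hlk, ?_⟩
  choose w hw z b ν hν hzb hlt hex using fun k : ℕ =>
    happ (Metric.ball w₀ (1 / ((k : ℝ) + 1))) (Metric.ball_mem_nhds _ Nat.one_div_pos_of_nat)
      (fun j => interior (s j) ∩ Metric.ball (y j w₀) (1 / ((k : ℝ) + 1)))
      (fun j => inter_mem (interior_mem_nhds.2 (hs j))
        (Metric.ball_mem_nhds _ Nat.one_div_pos_of_nat))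
      (1 / ((k : ℝ) + 1)) Nat.one_div_pos_of_nat
  have hzero : Tendsto (fun k : ℕ => 1 / ((k : ℝ) + 1)) atTop (𝓝 0) :=
    tendsto_one_div_add_atTop_nhds_zero_nat
  have hwt : Tendsto w atTop (𝓝 w₀) := tendsto_iff_dist_tendsto_zero.2
    (squeeze_zero (fun _ => dist_nonneg) (fun k => (Metric.mem_ball.1 (hw k).2).le) hzero)
  have hzt : ∀ j, Tendsto (fun k => z k j) atTop (𝓝 (y j w₀)) := fun j =>
    tendsto_iff_dist_tendsto_zero.2 (squeeze_zero (fun _ => dist_nonneg)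
      (fun k => (Metric.mem_ball.1 (hzb k j).1.2).le) hzero)
  have hbb : ∀ k, b k ∈ Metric.closedBall (0 : ι → G →L[ℝ] ℝ) (∑ j, K j) := by
    intro k
    have h0 : (0 : ℝ) ≤ ∑ j, (K j : ℝ) := Finset.sum_nonneg fun j _ => NNReal.coe_nonneg _
    rw [mem_closedBall_zero_iff, pi_norm_le_iff_of_nonneg h0]
    intro j
    refine (norm_le_of_mem_flatSubdiff (hzb k j).2
      (mem_interior_iff_mem_nhds.1 (hzb k j).1.1) (hK j)).trans ?_
    exact Finset.single_le_sum (f := fun j => (K j : ℝ)) (fun j _ => (K j).2) (Finset.mem_univ j)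
  have : ProperSpace (ι → G →L[ℝ] ℝ) := FiniteDimensional.proper ℝ _
  obtain ⟨a, -, t, ht, hta⟩ := tendsto_subseq_of_bounded Metric.isBounded_closedBall hbb
  have htt := ht.tendsto_atTop
  have hbt : ∀ j, Tendsto (fun k => b (t k) j) atTop (𝓝 (a j)) := fun j =>
    ((continuous_apply j).tendsto a).comp hta
  refine ⟨w ∘ t, ν ∘ t, z ∘ t, b ∘ t, a, fun k => ⟨(hw _).1, hν _⟩, hwt.comp htt, ?_,
    fun j => ⟨(hzt j).comp htt, hbt j⟩, fun k j => (hzb _ j).2, fun h k => hex _ h⟩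
  -- No compactness is needed for the normals: they differ by a null sequence from the negative of
  -- this convergent sum.
  have hsum : Tendsto (fun k => lam • fderiv ℝ J (w (t k)) +
      κ • ∑ j, (b (t k) j).comp (fderiv ℝ (y j) (w (t k)))) atTop
      (𝓝 (lam • fderiv ℝ J w₀ + κ • ∑ j, (a j).comp (fderiv ℝ (y j) w₀))) := by
    have h1 : Tendsto (fun k => fderiv ℝ J (w (t k))) atTop (𝓝 (fderiv ℝ J w₀)) :=
      (hJ.fderiv_right (m := 0) (by simp)).continuousAt.tendsto.comp (hwt.comp htt)
    have h2 : ∀ j, Tendsto (fun k => fderiv ℝ (y j) (w (t k))) atTop (𝓝 (fderiv ℝ (y j) w₀)) :=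
      fun j => ((hy j).fderiv_right (m := 0) (by simp)).continuousAt.tendsto.comp (hwt.comp htt)
    exact (h1.const_smul lam).add
      ((tendsto_finsetSum _ fun j _ => ((ContinuousLinearMap.compL ℝ W G ℝ).continuous₂.tendsto
        (a j, fderiv ℝ (y j) w₀)).comp ((hbt j).prodMk_nhds (h2 j))).const_smul κ)
  have herr : Tendsto (fun k => ν (t k) + (lam • fderiv ℝ J (w (t k)) +
      κ • ∑ j, (b (t k) j).comp (fderiv ℝ (y j) (w (t k))))) atTop (𝓝 0) :=
    squeeze_zero_norm (fun k => (hlt (t k)).le) (hzero.comp htt)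
  have := herr.sub hsum
  simpa [Function.comp_def] using this

end Multipliers

/-! ### Transfer of subgradients between charts and manifolds -/

section Charts

variable {d : ℕ} {M : Type*} [TopologicalSpace M] [ChartedSpace (EuclideanSpace ℝ (Fin d)) M]

/-- A `C¹` germ extends to a global `C¹` function. -/
theorem exists_contMDiff_eventuallyEq [T2Space M] [IsManifold (𝓡 d) ∞ M] {g : M → ℝ} {x : M}
    (hg : ContMDiffAt (𝓡 d) 𝓘(ℝ, ℝ) 1 g x) :
    ∃ g' : M → ℝ, ContMDiff (𝓡 d) 𝓘(ℝ, ℝ) 1 g' ∧ g' =ᶠ[𝓝 x] g := by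
  have hev : ∀ᶠ y in 𝓝 x, ContMDiffAt (𝓡 d) 𝓘(ℝ, ℝ) 1 g y := (contMDiffAt_iff_contMDiffAt_nhds (n := 1) (by simp)).1 hg
  obtain ⟨χ, -, hχ⟩ := (SmoothBumpFunction.nhds_basis_tsupport (I := 𝓡 d) x).mem_iff.1 hev
  refine ⟨fun y => χ y * g y, contMDiff_of_tsupport fun y hy => ?_, ?_⟩
  · have hy' : y ∈ tsupport χ := closure_mono (Function.support_mul_subset_left _ _) hy
    exact (χ.contMDiffAt.of_le (by simp)).mul (hχ hy')
  · filter_upwards [χ.eventuallyEq_one] with y hy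
    simp [hy]

/-- The derivative at `x` of the preferred chart at `q`, for `x` near `q`. -/
noncomputable def chartDeriv [IsManifold (𝓡 d) ∞ M] (q x : M) :
    TangentSpace (𝓡 d) x →L[ℝ] EuclideanSpace ℝ (Fin d) :=
  (trivializationAt (EuclideanSpace ℝ (Fin d)) (TangentSpace (𝓡 d) : M → Type _) q).continuousLinearMapAt
    ℝ x

theorem chartDeriv_eq_mfderiv [IsManifold (𝓡 d) ∞ M] {q x : M}
    (hx : x ∈ (extChartAt (𝓡 d) q).source) :
    chartDeriv q x = mfderiv (𝓡 d) (𝓡 d) (extChartAt (𝓡 d) q) x :=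
  have : IsManifold (𝓡 d) 1 M := IsManifold.of_le (n := ∞) (by simp)
  TangentBundle.continuousLinearMapAt_trivializationAt (by simpa using hx)

/-- In the trivialization at `q`, pulling back by `chartDeriv` undoes the coordinates; convergence
in `T^* M` thus reduces to convergence of coordinate covectors. -/
theorem inCoordinates_comp_chartDeriv [IsManifold (𝓡 d) ∞ M] {q y : M}
    (hy : y ∈ (chartAt (EuclideanSpace ℝ (Fin d)) q).source)
    (c : EuclideanSpace ℝ (Fin d) →L[ℝ] ℝ) :
    ContinuousLinearMap.inCoordinates (EuclideanSpace ℝ (Fin d)) (TangentSpace (𝓡 d) : M → Type _)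
      ℝ (Bundle.Trivial M ℝ) q y q y (c.comp (chartDeriv q y)) = c := by
  ext v
  have hy' : y ∈ (trivializationAt (EuclideanSpace ℝ (Fin d))
      (TangentSpace (𝓡 d) : M → Type _) q).baseSet := by simpa using hy
  have h1 := (trivializationAt (EuclideanSpace ℝ (Fin d))
    (TangentSpace (𝓡 d) : M → Type _) q).continuousLinearMapAt_symmL (R := ℝ) hy' v
  have h2 : ∀ r : ℝ, (trivializationAt ℝ (Bundle.Trivial M ℝ) q).continuousLinearMapAt ℝ y r
      = r := fun r => by simp
  rw [ContinuousLinearMap.inCoordinates, ContinuousLinearMap.comp_apply]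
  exact (h2 _).trans (congrArg c h1)

theorem covectorTendsto_of_chart [IsManifold (𝓡 d) ∞ M] {x : ℕ → M} {q : M}
    (hx : Tendsto x atTop (𝓝 q)) {b : ℕ → EuclideanSpace ℝ (Fin d) →L[ℝ] ℝ}
    {a : EuclideanSpace ℝ (Fin d) →L[ℝ] ℝ} (hb : Tendsto b atTop (𝓝 a)) :
    CovectorTendsto x (fun k => (b k).comp (chartDeriv q (x k))) q (a.comp (chartDeriv q q)) := by
  have hs : ∀ᶠ k in atTop, x k ∈ (chartAt (EuclideanSpace ℝ (Fin d)) q).source :=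
    hx ((chartAt (EuclideanSpace ℝ (Fin d)) q).open_source.mem_nhds (mem_chart_source _ q))
  have hcoord : Tendsto (fun k => ContinuousLinearMap.inCoordinates (EuclideanSpace ℝ (Fin d))
      (TangentSpace (𝓡 d) : M → Type _) ℝ (Bundle.Trivial M ℝ) q (x k) q (x k)
      ((b k).comp (chartDeriv q (x k)))) atTop
      (𝓝 (ContinuousLinearMap.inCoordinates (EuclideanSpace ℝ (Fin d))
      (TangentSpace (𝓡 d) : M → Type _) ℝ (Bundle.Trivial M ℝ) q q q q
      (a.comp (chartDeriv q q)))) := by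
    rw [inCoordinates_comp_chartDeriv (mem_chart_source _ q)]
    refine hb.congr' ?_
    filter_upwards [hs] with k hk
    exact (inCoordinates_comp_chartDeriv hk _).symm
  have key := (trivializationAt (EuclideanSpace ℝ (Fin d) →L[ℝ] ℝ)
    (fun y : M => TangentSpace (𝓡 d) y →L[ℝ] Bundle.Trivial M ℝ y) q).tendsto_nhds_iff
    (l := atTop) (f := fun k : ℕ => (⟨x k, (b k).comp (chartDeriv q (x k))⟩ :
      TotalSpace (EuclideanSpace ℝ (Fin d) →L[ℝ] ℝ)
        (fun y : M => TangentSpace (𝓡 d) y →L[ℝ] Bundle.Trivial M ℝ y)))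
    (FiberBundle.mem_trivializationAt_proj_source (x := ⟨q, a.comp (chartDeriv q q)⟩))
  exact key.2 ⟨hx, hcoord⟩

/-- Test functions in a chart are pulled back and, since the definition on `M` asks for global ones,
extended by a bump function. The chain rule identifies the covector. -/
theorem comp_chartDeriv_mem_frechetSubdiff [T2Space M] [IsManifold (𝓡 d) ∞ M] {f : M → EReal}
    {q x : M} (hx : x ∈ (extChartAt (𝓡 d) q).source) (hf : f x ≠ ⊤)
    {g : EuclideanSpace ℝ (Fin d) → ℝ} (hg : ContDiffAt ℝ 1 g (extChartAt (𝓡 d) q x))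
    (hmin : IsLocalMin (fun y => f y - (g (extChartAt (𝓡 d) q y) : EReal)) x) :
    (fderiv ℝ g (extChartAt (𝓡 d) q x)).comp (chartDeriv q x) ∈ frechetSubdiff f x := by
  have hc : ContMDiffAt (𝓡 d) (𝓡 d) 1 (extChartAt (𝓡 d) q) x :=
    (contMDiffAt_extChartAt' (I := 𝓡 d) (n := ∞) (x := q) (by simpa using hx)).of_le (by simp)
  have hgm : ContMDiffAt (𝓡 d) 𝓘(ℝ, ℝ) 1 g (extChartAt (𝓡 d) q x) := hg.contMDiffAt
  obtain ⟨g', hg', heq⟩ := exists_contMDiff_eventuallyEq (hgm.comp x hc)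
  refine ⟨hf, g', hg', ?_, ?_⟩
  · have h1 : mfderiv (𝓡 d) 𝓘(ℝ, ℝ) g' x = _ := heq.mfderiv_eq
    rw [mfderiv_comp x (hgm.mdifferentiableAt one_ne_zero) (hc.mdifferentiableAt one_ne_zero),
      mfderiv_eq_fderiv, ← chartDeriv_eq_mfderiv hx] at h1
    unfold mvfderiv
    rw [h1]
    rfl
  · filter_upwards [hmin, heq] with y hy hey
    rw [hey, heq.self_of_nhds]
    exact hy

theorem mem_limitingSubdiff_of_chart [IsManifold (𝓡 d) ∞ M] {f : M → EReal} {q : M} {x : ℕ → M}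
    (hx : Tendsto x atTop (𝓝 q)) {b : ℕ → EuclideanSpace ℝ (Fin d) →L[ℝ] ℝ}
    {a : EuclideanSpace ℝ (Fin d) →L[ℝ] ℝ} (hb : Tendsto b atTop (𝓝 a))
    (hf : Tendsto (fun k => f (x k)) atTop (𝓝 (f q)))
    (hmem : ∀ᶠ k in atTop, (b k).comp (chartDeriv q (x k)) ∈ frechetSubdiff f (x k)) :
    a.comp (chartDeriv q q) ∈ limitingSubdiff f q := by
  obtain ⟨N, hN⟩ := eventually_atTop.1 hmem
  -- Membership is only eventual, while the definition wants it for all indices; the sequence is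
  -- shifted.
  have ht : Tendsto (fun k => k + N) atTop atTop := tendsto_add_atTop_nat N
  exact ⟨fun k => x (k + N), fun k => (b (k + N)).comp (chartDeriv q (x (k + N))), hx.comp ht,
    fun k => hN _ (Nat.le_add_left _ _), hf.comp ht,
    covectorTendsto_of_chart (hx.comp ht) (hb.comp ht)⟩

theorem frechetSubdiff_subset_limitingSubdiff [IsManifold (𝓡 d) ∞ M] (f : M → EReal) (q : M) :
    frechetSubdiff (d := d) f q ⊆ limitingSubdiff f q := fun p hp =>
  ⟨fun _ => q, fun _ => p, tendsto_const_nhds, fun _ => hp, tendsto_const_nhds,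
    tendsto_const_nhds (f := atTop)⟩

theorem mem_frechetSubdiff_of_flatSubdiff [T2Space M] [IsManifold (𝓡 d) ∞ M] {φ : M → ℝ} {q : M}
    {z : EuclideanSpace ℝ (Fin d)} (hz : z ∈ (extChartAt (𝓡 d) q).target)
    {b : EuclideanSpace ℝ (Fin d) →L[ℝ] ℝ}
    (hb : b ∈ flatSubdiff (φ ∘ (extChartAt (𝓡 d) q).symm) z) :
    b.comp (chartDeriv q ((extChartAt (𝓡 d) q).symm z)) ∈
      frechetSubdiff (fun x => (φ x : EReal)) ((extChartAt (𝓡 d) q).symm z) := by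
  obtain ⟨g, hg, rfl, hmin⟩ := hb
  have hx := (extChartAt (𝓡 d) q).map_target hz
  have hr := (extChartAt (𝓡 d) q).right_inv hz
  have := comp_chartDeriv_mem_frechetSubdiff (f := fun x => (φ x : EReal)) hx (by simp)
    (g := g) (by rwa [hr]) ?_
  · rwa [hr] at this
  · have hcont : Tendsto (extChartAt (𝓡 d) q) (𝓝 ((extChartAt (𝓡 d) q).symm z)) (𝓝 z) := by
      exact (continuousAt_extChartAt' (I := 𝓡 d) hx).trans_eq (congrArg 𝓝 hr)
    filter_upwards [hcont.eventually hmin, extChartAt_source_mem_nhds' (I := 𝓡 d) hx] with y hy hys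
    simp only [Function.comp_apply, (extChartAt (𝓡 d) q).left_inv hys] at hy
    rw [hr, ← EReal.coe_sub, ← EReal.coe_sub]
    exact EReal.coe_le_coe_iff.2 hy

/-- The part of a subset of a manifold visible in the preferred chart at `q`. -/
def chartImage (q : M) (S : Set M) : Set (EuclideanSpace ℝ (Fin d)) :=
  (extChartAt (𝓡 d) q).target ∩ (extChartAt (𝓡 d) q).symm ⁻¹' S

theorem mem_frechetSubdiff_of_flatNormal [T2Space M] [IsManifold (𝓡 d) ∞ M] {S : Set M} {q : M}
    {z : EuclideanSpace ℝ (Fin d)} (hz : z ∈ chartImage q S)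
    {b : EuclideanSpace ℝ (Fin d) →L[ℝ] ℝ} (hb : b ∈ flatNormal (chartImage q S) z) :
    b.comp (chartDeriv q ((extChartAt (𝓡 d) q).symm z)) ∈
      frechetSubdiff (indicatorFn S) ((extChartAt (𝓡 d) q).symm z) := by
  obtain ⟨g, hg, rfl, hmax⟩ := hb
  have hx := (extChartAt (𝓡 d) q).map_target hz.1
  have hr := (extChartAt (𝓡 d) q).right_inv hz.1
  have hS : indicatorFn S ((extChartAt (𝓡 d) q).symm z) = 0 := if_pos hz.2
  have := comp_chartDeriv_mem_frechetSubdiff (f := indicatorFn S) hx (hS ▸ EReal.zero_ne_top)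
    (g := g) (by rwa [hr]) ?_
  · rwa [hr] at this
  · have hcont : Tendsto (extChartAt (𝓡 d) q) (𝓝 ((extChartAt (𝓡 d) q).symm z)) (𝓝 z) := by
      exact (continuousAt_extChartAt' (I := 𝓡 d) hx).trans_eq (congrArg 𝓝 hr)
    filter_upwards [hcont.eventually (eventually_nhdsWithin_iff.1 hmax),
      extChartAt_source_mem_nhds' (I := 𝓡 d) hx] with y hy hys
    rw [hS, hr]
    by_cases hyS : y ∈ S
    · have h1 : indicatorFn S y = 0 := if_pos hyS
      have h2 := hy ⟨(extChartAt (𝓡 d) q).map_source hys, by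
        rwa [mem_preimage, (extChartAt (𝓡 d) q).left_inv hys]⟩
      rw [h1, zero_sub, zero_sub]
      exact EReal.neg_le_neg_iff.2 (EReal.coe_le_coe_iff.2 h2)
    · have h1 : indicatorFn S y = ⊤ := if_neg hyS
      rw [h1, EReal.top_sub_coe]
      exact le_top

/-- The transition from the preferred chart to the given Lipschitz chart is `C¹`, hence Lipschitz
near the point. -/
theorem LocLipschitz.exists_lipschitzOnWith_extChartAt [IsManifold (𝓡 d) ∞ M] {φ : M → ℝ}
    (hφ : LocLipschitz d φ) (q : M) :
    ∃ K : NNReal, ∃ s ∈ 𝓝 (extChartAt (𝓡 d) q q),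
      LipschitzOnWith K (φ ∘ (extChartAt (𝓡 d) q).symm) s := by
  obtain ⟨e, he, hqe, K, hK⟩ := hφ q
  have h1 : ContMDiffAt (𝓡 d) (𝓡 d) 1 e q :=
    (contMDiffAt_of_mem_maximalAtlas he hqe).of_le (by simp)
  have h2 : ContMDiffAt (𝓡 d) (𝓡 d) 1 (extChartAt (𝓡 d) q).symm (extChartAt (𝓡 d) q q) :=
    ((contMDiffOn_extChartAt_symm (n := ∞) q).contMDiffAt
      (extChartAt_target_mem_nhds (I := 𝓡 d) q)).of_le (by simp)
  have hq : (extChartAt (𝓡 d) q).symm (extChartAt (𝓡 d) q q) = q := extChartAt_to_inv q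
  have h3 : ContDiffAt ℝ 1 (e ∘ (extChartAt (𝓡 d) q).symm) (extChartAt (𝓡 d) q q) := by
    rw [← contMDiffAt_iff_contDiffAt]
    exact ContMDiffAt.comp _ (by rwa [hq]) h2
  obtain ⟨K', s, hs, hK'⟩ := h3.exists_lipschitzOnWith
  have hmem : ∀ᶠ z in 𝓝 (extChartAt (𝓡 d) q q), (extChartAt (𝓡 d) q).symm z ∈ e.source :=
    h2.continuousAt.eventually (e.open_source.mem_nhds (by rwa [hq]))
  refine ⟨K * K', s ∩ {z | (extChartAt (𝓡 d) q).symm z ∈ e.source}, inter_mem hs hmem, ?_⟩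
  have hcomp := hK.comp (hK'.mono (inter_subset_left (t := {z | (extChartAt (𝓡 d) q).symm z ∈
    e.source}))) fun z hz => e.map_source hz.2
  intro z hz z' hz'
  have := hcomp hz hz'
  simpa only [Function.comp_apply, e.left_inv hz.2, e.left_inv hz'.2] using this

theorem LocLipschitz.continuous [IsManifold (𝓡 d) ∞ M] {φ : M → ℝ} (hφ : LocLipschitz d φ) :
    Continuous φ := by
  refine continuous_iff_continuousAt.2 fun q => ?_
  obtain ⟨e, -, hqe, K, hK⟩ := hφ q
  have h1 : ContinuousAt ((φ ∘ e.symm) ∘ e) q :=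
    ContinuousAt.comp (hK.continuousOn.continuousAt (e.open_target.mem_nhds (e.map_source hqe)))
      (e.continuousAt hqe)
  refine h1.congr ?_
  filter_upwards [e.open_source.mem_nhds hqe] with x hx
  simp [e.left_inv hx]

/-- Continuity of the metric bounds the chart derivatives near `q`, so covectors small in
coordinates are small in the dual norm. -/
theorem eventually_norm_comp_chartDeriv_le [IsManifold (𝓡 d) ∞ M]
    [RiemannianBundle (fun q : M => TangentSpace (𝓡 d) q)]
    [IsContinuousRiemannianBundle (EuclideanSpace ℝ (Fin d))
      (fun q : M => TangentSpace (𝓡 d) q)] (q : M) :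
    ∃ C > 0, ∀ᶠ x in 𝓝 q, ∀ b : EuclideanSpace ℝ (Fin d) →L[ℝ] ℝ,
      ‖b.comp (chartDeriv q x)‖ ≤ ‖b‖ * C := by
  obtain ⟨C, hC, h⟩ := eventually_norm_trivializationAt_lt (EuclideanSpace ℝ (Fin d))
    (fun q : M => TangentSpace (𝓡 d) q) q
  refine ⟨C, hC, h.mono fun x hx b => ?_⟩
  exact (ContinuousLinearMap.opNorm_comp_le b _).trans
    (mul_le_mul_of_nonneg_left hx.le (norm_nonneg _))

end Charts

/-! ### Derivatives of states and cost; the adjoint recursion -/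

/-- Here `P j` and `A j` stand for `p j` and the subgradient paired with the variation of the `j`-th
state. They vanish at `0` because the initial state is fixed; summing the step relations cancels the
interior `P j`. -/
theorem sum_adjoint_telescope {n : ℕ} {lam κ dl : ℝ} {P A : Fin (n + 1) → ℝ}
    {Lq Lu Fu : Fin n → ℝ} (hlast : -P (Fin.last n) = lam * dl + κ * A (Fin.last n))
    (hstep : ∀ i : Fin n, -P i.castSucc + (P i.succ - Fu i) = lam * Lq i + κ * A i.castSucc)
    (hP : P 0 = 0) (hA : A 0 = 0) :
    lam * (dl + ∑ i, (Lq i + Lu i)) + κ * ∑ i : Fin n, A i.succ = ∑ i, (lam * Lu i - Fu i) := by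
  have h1 := Finset.sum_congr (rfl : (Finset.univ : Finset (Fin n)) = _) fun i _ => hstep i
  have hPs := (Fin.sum_univ_succ P).symm.trans (Fin.sum_univ_castSucc P)
  have hAs := (Fin.sum_univ_succ A).symm.trans (Fin.sum_univ_castSucc A)
  simp only [Finset.sum_add_distrib, Finset.sum_sub_distrib, Finset.sum_neg_distrib,
    ← Finset.mul_sum] at h1 ⊢
  rw [hP, zero_add] at hPs
  rw [hA, zero_add] at hAs
  rw [hAs]
  linear_combination -hlast - h1 + hPs

section Derivatives

theorem mfderiv_comp_prodMk_apply
    {E₀ H₀ X E₁ H₁ M₁ E₂ H₂ M₂ E₃ H₃ M₃ : Type*}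
    [NormedAddCommGroup E₀] [NormedSpace ℝ E₀] [TopologicalSpace H₀]
    {I₀ : ModelWithCorners ℝ E₀ H₀} [TopologicalSpace X] [ChartedSpace H₀ X]
    [NormedAddCommGroup E₁] [NormedSpace ℝ E₁] [TopologicalSpace H₁]
    {I₁ : ModelWithCorners ℝ E₁ H₁} [TopologicalSpace M₁] [ChartedSpace H₁ M₁]
    [NormedAddCommGroup E₂] [NormedSpace ℝ E₂] [TopologicalSpace H₂]
    {I₂ : ModelWithCorners ℝ E₂ H₂} [TopologicalSpace M₂] [ChartedSpace H₂ M₂]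
    [NormedAddCommGroup E₃] [NormedSpace ℝ E₃] [TopologicalSpace H₃]
    {I₃ : ModelWithCorners ℝ E₃ H₃} [TopologicalSpace M₃] [ChartedSpace H₃ M₃]
    {f : M₁ × M₂ → M₃} {a : X → M₁} {b : X → M₂} {x : X}
    (hf : MDifferentiableAt (I₁.prod I₂) I₃ f (a x, b x))
    (ha : MDifferentiableAt I₀ I₁ a x) (hb : MDifferentiableAt I₀ I₂ b x)
    (v : TangentSpace I₀ x) :
    mfderiv I₀ I₃ (fun y => f (a y, b y)) x v =
      mfderiv I₁ I₃ (fun z => f (z, b x)) (a x) (mfderiv I₀ I₁ a x v) +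
        mfderiv I₂ I₃ (fun z => f (a x, z)) (b x) (mfderiv I₀ I₂ b x v) := by
  have h1 := mfderiv_comp (I' := I₁.prod I₂) x (g := f) (f := fun y => (a y, b y)) hf
    (ha.prodMk hb)
  have h2 : mfderiv I₀ I₃ (fun y => f (a y, b y)) x v =
      mfderiv (I₁.prod I₂) I₃ f (a x, b x)
        (mfderiv I₀ (I₁.prod I₂) (fun y => (a y, b y)) x v) := DFunLike.congr_fun h1 v
  rw [h2, mfderiv_prod_eq_add_apply hf, mfderiv_prodMk ha hb]
  rfl

variable {d n : ℕ} {m : Fin n → ℕ}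
  {Q : Type*} [TopologicalSpace Q]
  [ChartedSpace (EuclideanSpace ℝ (Fin d)) Q]
  {U : Fin n → Type*} [∀ i, TopologicalSpace (U i)]
  [∀ i, ChartedSpace (EuclideanSpace ℝ (Fin (m i))) (U i)]
  {F : ∀ i, Q × U i → Q} {ℓ : Q → ℝ} {L : ∀ i, Q × U i → ℝ} {q₀ : Q}
  {W : Type*} [NormedAddCommGroup W] [NormedSpace ℝ W] {c : ∀ i, W → U i} {w₀ : W}

theorem contMDiffAt_stateSeq (hF : ∀ i, ContMDiff ((𝓡 d).prod (𝓡 (m i))) (𝓡 d) 1 (F i))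
    (hc : ∀ i, ContMDiffAt 𝓘(ℝ, W) (𝓡 (m i)) 1 (c i) w₀) (j : Fin (n + 1)) :
    ContMDiffAt 𝓘(ℝ, W) (𝓡 d) 1 (fun w => stateSeq F q₀ (fun i => c i w) j) w₀ := by
  induction j using Fin.induction with
  | zero => exact contMDiffAt_const
  | succ i ih => exact ((hF i).contMDiffAt).comp w₀ (ih.prodMk (hc i))

theorem contDiffAt_cost (hF : ∀ i, ContMDiff ((𝓡 d).prod (𝓡 (m i))) (𝓡 d) 1 (F i))
    (hℓ : ContMDiff (𝓡 d) 𝓘(ℝ, ℝ) 1 ℓ)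
    (hL : ∀ i, ContMDiff ((𝓡 d).prod (𝓡 (m i))) 𝓘(ℝ, ℝ) 1 (L i))
    (hc : ∀ i, ContMDiffAt 𝓘(ℝ, W) (𝓡 (m i)) 1 (c i) w₀) :
    ContDiffAt ℝ 1 (fun w => cost F q₀ ℓ L (fun i => c i w)) w₀ := by
  have h1 : ContDiffAt ℝ 1 (fun w => ℓ (stateSeq F q₀ (fun i => c i w) (Fin.last n))) w₀ :=
    (hℓ.contMDiffAt.comp w₀ (contMDiffAt_stateSeq hF hc _)).contDiffAt
  refine h1.add (ContDiffAt.sum fun i _ => ?_)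
  exact ((hL i).contMDiffAt.comp w₀ ((contMDiffAt_stateSeq hF hc _).prodMk (hc i))).contDiffAt

theorem fderiv_cost_apply (hF : ∀ i, ContMDiff ((𝓡 d).prod (𝓡 (m i))) (𝓡 d) 1 (F i))
    (hℓ : ContMDiff (𝓡 d) 𝓘(ℝ, ℝ) 1 ℓ)
    (hL : ∀ i, ContMDiff ((𝓡 d).prod (𝓡 (m i))) 𝓘(ℝ, ℝ) 1 (L i))
    (hc : ∀ i, ContMDiffAt 𝓘(ℝ, W) (𝓡 (m i)) 1 (c i) w₀) (δ : W) :
    fderiv ℝ (fun w => cost F q₀ ℓ L (fun i => c i w)) w₀ δ =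
      mvfderiv (𝓡 d) ℓ (stateSeq F q₀ (fun i => c i w₀) (Fin.last n))
        (mfderiv 𝓘(ℝ, W) (𝓡 d) (fun w => stateSeq F q₀ (fun i => c i w) (Fin.last n)) w₀ δ) +
      ∑ i : Fin n,
        (mvfderiv (𝓡 d) (fun q => L i (q, c i w₀)) (stateSeq F q₀ (fun i => c i w₀) i.castSucc)
          (mfderiv 𝓘(ℝ, W) (𝓡 d) (fun w => stateSeq F q₀ (fun i => c i w) i.castSucc) w₀ δ) +
        mvfderiv (𝓡 (m i)) (fun v => L i (stateSeq F q₀ (fun i => c i w₀) i.castSucc, v)) (c i w₀)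
          (mfderiv 𝓘(ℝ, W) (𝓡 (m i)) (c i) w₀ δ)) := by
  have hS := fun j => contMDiffAt_stateSeq (q₀ := q₀) hF hc j
  have h1 : ContMDiffAt 𝓘(ℝ, W) 𝓘(ℝ, ℝ) 1
      (fun w => ℓ (stateSeq F q₀ (fun i => c i w) (Fin.last n))) w₀ :=
    hℓ.contMDiffAt.comp w₀ (hS _)
  have h2 : ∀ i, ContMDiffAt 𝓘(ℝ, W) 𝓘(ℝ, ℝ) 1
      (fun w => L i (stateSeq F q₀ (fun i => c i w) i.castSucc, c i w)) w₀ := fun i =>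
    (hL i).contMDiffAt.comp w₀ ((hS _).prodMk (hc i))
  have hd := (h1.contDiffAt.differentiableAt one_ne_zero).hasFDerivAt.fun_add
    (HasFDerivAt.fun_sum (u := Finset.univ) fun i _ =>
      ((h2 i).contDiffAt.differentiableAt one_ne_zero).hasFDerivAt)
  have hd' : fderiv ℝ (fun w => cost F q₀ ℓ L (fun i => c i w)) w₀ = _ := hd.fderiv
  rw [hd', add_apply, sum_apply]
  congr 1
  · have := mfderiv_comp w₀ (hℓ.contMDiffAt.mdifferentiableAt one_ne_zero)
      ((hS (Fin.last n)).mdifferentiableAt one_ne_zero)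
    rw [← mfderiv_eq_fderiv]
    exact DFunLike.congr_fun this δ
  · refine Finset.sum_congr rfl fun i _ => ?_
    rw [← mfderiv_eq_fderiv]
    exact mfderiv_comp_prodMk_apply ((hL i).contMDiffAt.mdifferentiableAt one_ne_zero)
      ((hS _).mdifferentiableAt one_ne_zero) ((hc i).mdifferentiableAt one_ne_zero) δ

theorem mfderiv_stateSeq_succ_apply
    (hF : ∀ i, ContMDiff ((𝓡 d).prod (𝓡 (m i))) (𝓡 d) 1 (F i))
    (hc : ∀ i, ContMDiffAt 𝓘(ℝ, W) (𝓡 (m i)) 1 (c i) w₀) (i : Fin n) (δ : W) :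
    mfderiv 𝓘(ℝ, W) (𝓡 d) (fun w => stateSeq F q₀ (fun i => c i w) i.succ) w₀ δ =
      mfderiv (𝓡 d) (𝓡 d) (fun q => F i (q, c i w₀))
        (stateSeq F q₀ (fun i => c i w₀) i.castSucc)
        (mfderiv 𝓘(ℝ, W) (𝓡 d) (fun w => stateSeq F q₀ (fun i => c i w) i.castSucc) w₀ δ) +
      mfderiv (𝓡 (m i)) (𝓡 d) (fun v => F i (stateSeq F q₀ (fun i => c i w₀) i.castSucc, v))
        (c i w₀) (mfderiv 𝓘(ℝ, W) (𝓡 (m i)) (c i) w₀ δ) :=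
  mfderiv_comp_prodMk_apply ((hF i).contMDiffAt.mdifferentiableAt one_ne_zero)
    ((contMDiffAt_stateSeq (q₀ := q₀) hF hc i.castSucc).mdifferentiableAt one_ne_zero)
    ((hc i).mdifferentiableAt one_ne_zero) δ

/-- Backward recursion makes the first two relations true by definition. The third follows by
pairing with the state variation caused by `δ`: the derivative of the penalized cost reduces to
partial derivatives in the controls. -/
theorem exists_adjoint [IsManifold (𝓡 d) ∞ Q]
    (hF : ∀ i, ContMDiff ((𝓡 d).prod (𝓡 (m i))) (𝓡 d) 1 (F i))
    (hℓ : ContMDiff (𝓡 d) 𝓘(ℝ, ℝ) 1 ℓ)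
    (hL : ∀ i, ContMDiff ((𝓡 d).prod (𝓡 (m i))) 𝓘(ℝ, ℝ) 1 (L i))
    (hc : ∀ i, ContMDiffAt 𝓘(ℝ, W) (𝓡 (m i)) 1 (c i) w₀)
    {u : ∀ i, U i} (hcu : (fun i => c i w₀) = u) (lam κ : ℝ)
    {b : Fin n → EuclideanSpace ℝ (Fin d) →L[ℝ] ℝ} {a : ∀ j, Covector d (stateSeq F q₀ u j)}
    (hab : ∀ i : Fin n, a i.succ =
      (b i).comp (chartDeriv (stateSeq F q₀ u i.succ) (stateSeq F q₀ u i.succ))) :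
    ∃ p : ∀ j, Covector d (stateSeq F q₀ u j),
      -p (Fin.last n) = lam • mvfderiv (𝓡 d) ℓ (stateSeq F q₀ u (Fin.last n)) +
        κ • a (Fin.last n) ∧
      (∀ i : Fin n, -p i.castSucc + (p i.succ).comp
          (mfderiv (𝓡 d) (𝓡 d) (fun q => F i (q, u i)) (stateSeq F q₀ u i.castSucc)) =
        lam • mvfderiv (𝓡 d) (fun q => L i (q, u i)) (stateSeq F q₀ u i.castSucc) +
          κ • a i.castSucc) ∧
      ∀ (δ : W) (v : ∀ i, EuclideanSpace ℝ (Fin (m i))),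
        (∀ i, mfderiv 𝓘(ℝ, W) (𝓡 (m i)) (c i) w₀ δ = v i) →
        lam * fderiv ℝ (fun w => cost F q₀ ℓ L (fun i => c i w)) w₀ δ +
          κ * ∑ i, b i (fderiv ℝ (fun w => extChartAt (𝓡 d) (stateSeq F q₀ u i.succ)
            (stateSeq F q₀ (fun i => c i w) i.succ)) w₀ δ) =
        ∑ i, (lam * mvfderiv (𝓡 (m i)) (fun z => L i (stateSeq F q₀ u i.castSucc, z)) (u i) (v i) -
          p i.succ (mfderiv (𝓡 (m i)) (𝓡 d)
            (fun z => F i (stateSeq F q₀ u i.castSucc, z)) (u i) (v i))) := by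
  -- Replacing `u` by `c i w₀` makes the base points of all covectors agree definitionally.
  subst hcu
  let q := stateSeq F q₀ (fun i => c i w₀)
  let p : ∀ j, Covector d (q j) := Fin.reverseInduction
    (motive := fun j => Covector d (q j))
    (-(lam • mvfderiv (𝓡 d) ℓ (q (Fin.last n)) + κ • a (Fin.last n)))
    (fun i p' => ContinuousLinearMap.comp p'
        (mfderiv (𝓡 d) (𝓡 d) (fun x => F i (x, c i w₀)) (q i.castSucc)) -
      (lam • mvfderiv (𝓡 d) (fun x => L i (x, c i w₀)) (q i.castSucc) + κ • a i.castSucc))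
  have hlast : p (Fin.last n) =
      -(lam • mvfderiv (𝓡 d) ℓ (q (Fin.last n)) + κ • a (Fin.last n)) :=
    Fin.reverseInduction_last
  have hstep : ∀ i : Fin n, p i.castSucc = ContinuousLinearMap.comp (p i.succ)
        (mfderiv (𝓡 d) (𝓡 d) (fun x => F i (x, c i w₀)) (q i.castSucc)) -
      (lam • mvfderiv (𝓡 d) (fun x => L i (x, c i w₀)) (q i.castSucc) + κ • a i.castSucc) :=
    fun i => Fin.reverseInduction_castSucc i
  have h1 : -p (Fin.last n) = lam • mvfderiv (𝓡 d) ℓ (q (Fin.last n)) + κ • a (Fin.last n) := by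
    rw [hlast, neg_neg]
  have h2 : ∀ i : Fin n, -p i.castSucc + (p i.succ).comp
      (mfderiv (𝓡 d) (𝓡 d) (fun x => F i (x, c i w₀)) (q i.castSucc)) =
      lam • mvfderiv (𝓡 d) (fun x => L i (x, c i w₀)) (q i.castSucc) + κ • a i.castSucc := by
    intro i
    rw [hstep i, neg_sub, sub_add_cancel]
  refine ⟨p, h1, h2, fun δ v hv => ?_⟩
  set s : ∀ j, TangentSpace (𝓡 d) (q j) := fun j =>
    mfderiv 𝓘(ℝ, W) (𝓡 d) (fun w => stateSeq F q₀ (fun i => c i w) j) w₀ δ with hs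
  have hs0 : s 0 = 0 := by
    have : mfderiv 𝓘(ℝ, W) (𝓡 d) (fun _ : W => q₀) w₀ = 0 := mfderiv_const
    exact DFunLike.congr_fun this δ
  have hb : ∀ i : Fin n, b i (fderiv ℝ (fun w => extChartAt (𝓡 d) (q i.succ)
      (stateSeq F q₀ (fun i => c i w) i.succ)) w₀ δ) = a i.succ (s i.succ) := by
    intro i
    have hsrc : q i.succ ∈ (extChartAt (𝓡 d) (q i.succ)).source := mem_extChartAt_source _
    have := mfderiv_comp w₀ (I' := 𝓡 d) (g := extChartAt (𝓡 d) (q i.succ))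
      (f := fun w => stateSeq F q₀ (fun i => c i w) i.succ)
      ((contMDiffAt_extChartAt (I := 𝓡 d) (n := ∞)).mdifferentiableAt (by simp))
      ((contMDiffAt_stateSeq hF hc _).mdifferentiableAt one_ne_zero)
    rw [hab, chartDeriv_eq_mfderiv hsrc, ← mfderiv_eq_fderiv]
    exact congrArg (b i) (DFunLike.congr_fun this δ)
  have hcost := fderiv_cost_apply (q₀ := q₀) hF hℓ hL hc δ
  rw [hcost, Finset.sum_congr rfl fun i _ => hb i]
  have := sum_adjoint_telescope (n := n) (lam := lam) (κ := κ)
    (dl := mvfderiv (𝓡 d) ℓ (q (Fin.last n)) (s (Fin.last n)))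
    (P := fun j => p j (s j)) (A := fun j => a j (s j))
    (Lq := fun i => mvfderiv (𝓡 d) (fun x => L i (x, c i w₀)) (q i.castSucc) (s i.castSucc))
    (Lu := fun i => mvfderiv (𝓡 (m i)) (fun z => L i (q i.castSucc, z)) (c i w₀) (v i))
    (Fu := fun i => p i.succ (mfderiv (𝓡 (m i)) (𝓡 d)
            (fun z => F i (q i.castSucc, z)) (c i w₀) (v i)))
    (DFunLike.congr_fun h1 _) (fun i => ?_) ?_ ?_
  · rw [← this]
    congr 3
    refine Finset.sum_congr rfl fun i _ => ?_
    rw [hv i]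
  · have h3 : s i.succ = mfderiv (𝓡 d) (𝓡 d) (fun x => F i (x, c i w₀)) (q i.castSucc)
        (s i.castSucc) + mfderiv (𝓡 (m i)) (𝓡 d) (fun z => F i (q i.castSucc, z)) (c i w₀)
        (v i) := by
      rw [← hv i]
      exact mfderiv_stateSeq_succ_apply hF hc i δ
    have h4 := DFunLike.congr_fun (h2 i) (s i.castSucc)
    have h5 := congrArg (p i.succ) h3
    have h6 := map_add (p i.succ) (mfderiv (𝓡 d) (𝓡 d) (fun x => F i (x, c i w₀)) (q i.castSucc)
        (s i.castSucc)) (mfderiv (𝓡 (m i)) (𝓡 d) (fun z => F i (q i.castSucc, z)) (c i w₀)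
        (v i))
    refine Eq.trans ?_ h4
    show _ = -p i.castSucc (s i.castSucc) + p i.succ (mfderiv (𝓡 d) (𝓡 d)
      (fun x => F i (x, c i w₀)) (q i.castSucc) (s i.castSucc))
    congr 1
    exact sub_eq_iff_eq_add.2 (h5.trans h6)
  · exact (congrArg (p 0) hs0).trans (map_zero _)
  · exact (congrArg (a 0) hs0).trans (map_zero _)

end Derivatives

/-! ### Normals to products -/

section Products

variable {n : ℕ} {E : Fin n → Type*} [∀ i, NormedAddCommGroup (E i)] [∀ i, NormedSpace ℝ (E i)]

/-- Freeze all coordinates of the test function but the `i`-th. -/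
theorem comp_single_mem_flatNormal {D : ∀ i, Set (E i)} {w : ∀ i, E i}
    (hw : w ∈ univ.pi D) {ν : (∀ i, E i) →L[ℝ] ℝ} (hν : ν ∈ flatNormal (univ.pi D) w) (i : Fin n) :
    ν.comp (ContinuousLinearMap.single ℝ E i) ∈ flatNormal (D i) (w i) := by
  obtain ⟨g, hg, rfl, hmax⟩ := hν
  have hupd : ContDiff ℝ 1 (Function.update w i) := contDiff_update 1 w i
  have hwi : Function.update w i (w i) = w := Function.update_eq_self i w
  refine ⟨fun v => g (Function.update w i v), ?_, ?_, ?_⟩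
  · exact ContDiffAt.comp (w i) (by rwa [hwi]) hupd.contDiffAt
  · have h1 : HasFDerivAt g (fderiv ℝ g w) (Function.update w i (w i)) := by
      rw [hwi]; exact (hg.differentiableAt one_ne_zero).hasFDerivAt
    have h2 := h1.comp (w i) (hasFDerivAt_update w (w i))
    refine h2.fderiv.trans ?_
    ext v
    simp only [ContinuousLinearMap.comp_apply]
    congr 1
    ext j
    rcases eq_or_ne j i with rfl | hj
    · simp
    · simp [hj]
  · have ht : Tendsto (Function.update w i) (𝓝[D i] (w i)) (𝓝[univ.pi D] w) := by
      refine tendsto_nhdsWithin_iff.2 ⟨?_, ?_⟩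
      · have := hupd.continuous.tendsto (w i)
        rw [hwi] at this
        exact this.mono_left nhdsWithin_le_nhds
      · filter_upwards [self_mem_nhdsWithin] with v hv j _
        rcases eq_or_ne j i with rfl | hj
        · simpa using hv
        · simpa [hj] using hw j trivial
    filter_upwards [ht.eventually hmax] with v hv
    rwa [hwi]

end Products

/-! ### Limits of chart subgradients and normals -/

section ChartImages

variable {d : ℕ} {M : Type*} [TopologicalSpace M] [ChartedSpace (EuclideanSpace ℝ (Fin d)) M]

/-- The chart target is only open, so `chartImage` need not be closed; but small closed balls lie
inside the target. -/
theorem eventually_isCompact_chartImage_inter (q : M) {S : Set M} (hS : IsClosed S) :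
    ∀ᶠ r : ℝ in 𝓝[>] 0, IsCompact (chartImage q S ∩ Metric.closedBall (extChartAt (𝓡 d) q q) r) := by
  obtain ⟨s, hs, hsub⟩ := Metric.nhds_basis_closedBall.mem_iff.1
    (extChartAt_target_mem_nhds (I := 𝓡 d) q)
  filter_upwards [Ioo_mem_nhdsGT hs] with r hr
  have hr' : Metric.closedBall (extChartAt (𝓡 d) q q) r ⊆ (extChartAt (𝓡 d) q).target :=
    (Metric.closedBall_subset_closedBall hr.2.le).trans hsub
  have : chartImage q S ∩ Metric.closedBall (extChartAt (𝓡 d) q q) r =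
      Metric.closedBall (extChartAt (𝓡 d) q q) r ∩ (extChartAt (𝓡 d) q).symm ⁻¹' S := by
    ext z
    exact ⟨fun h => ⟨h.2, h.1.2⟩, fun h => ⟨⟨hr' h.1, h.2⟩, h.1⟩⟩
  rw [this]
  exact (isCompact_closedBall _ _).of_isClosed_subset
    (((continuousOn_extChartAt_symm (I := 𝓡 d) q).mono hr').preimage_isClosed_of_isClosed
      Metric.isClosed_closedBall hS) inter_subset_left

theorem mfderiv_extChartAt_symm_chartDeriv [IsManifold (𝓡 d) ∞ M] (q : M)
    (v : TangentSpace (𝓡 d) q) :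
    mfderiv (𝓡 d) (𝓡 d) (extChartAt (𝓡 d) q).symm (extChartAt (𝓡 d) q q) (chartDeriv q q v) =
      v := by
  have : IsManifold (𝓡 d) 1 M := IsManifold.of_le (n := ∞) (by simp)
  have h := mfderivWithin_extChartAt_symm_comp_mfderiv_extChartAt' (I := 𝓡 d) (x := q)
    (mem_extChartAt_source (I := 𝓡 d) q)
  rw [← chartDeriv_eq_mfderiv (mem_extChartAt_source q), ModelWithCorners.range_eq_univ,
    mfderivWithin_univ] at h
  exact DFunLike.congr_fun h v

theorem chartDeriv_surjective [IsManifold (𝓡 d) ∞ M] (q : M) :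
    Function.Surjective (chartDeriv (d := d) q q) := by
  have : IsManifold (𝓡 d) 1 M := IsManifold.of_le (n := ∞) (by simp)
  have h := mfderiv_extChartAt_comp_mfderivWithin_extChartAt_symm' (I := 𝓡 d) (x := q)
    (mem_extChartAt_source (I := 𝓡 d) q)
  rw [← chartDeriv_eq_mfderiv (mem_extChartAt_source q), ModelWithCorners.range_eq_univ,
    mfderivWithin_univ] at h
  exact fun v => ⟨_, DFunLike.congr_fun h v⟩

theorem comp_chartDeriv_mem_limitingSubdiffReal [T2Space M] [IsManifold (𝓡 d) ∞ M] {φ : M → ℝ}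
    (hφ : Continuous φ) {q : M} {z : ℕ → EuclideanSpace ℝ (Fin d)}
    (hz : Tendsto z atTop (𝓝 (extChartAt (𝓡 d) q q)))
    {b : ℕ → EuclideanSpace ℝ (Fin d) →L[ℝ] ℝ} {a : EuclideanSpace ℝ (Fin d) →L[ℝ] ℝ}
    (hb : Tendsto b atTop (𝓝 a))
    (hmem : ∀ k, b k ∈ flatSubdiff (φ ∘ (extChartAt (𝓡 d) q).symm) (z k)) :
    a.comp (chartDeriv q q) ∈ limitingSubdiffReal φ q := by
  have hx : Tendsto (fun k => (extChartAt (𝓡 d) q).symm (z k)) atTop (𝓝 q) := by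
    have := (continuousAt_extChartAt_symm (I := 𝓡 d) q).tendsto.comp hz
    rwa [extChartAt_to_inv] at this
  refine mem_limitingSubdiff_of_chart hx hb ?_ ?_
  · exact (continuous_coe_real_ereal.comp hφ).continuousAt.tendsto.comp hx
  · filter_upwards [hz (extChartAt_target_mem_nhds (I := 𝓡 d) q)] with k hk
    exact mem_frechetSubdiff_of_flatSubdiff hk (hmem k)

theorem comp_chartDeriv_mem_limitingNormalCone [T2Space M] [IsManifold (𝓡 d) ∞ M] {S : Set M}
    {q : M} (hq : q ∈ S) {z : ℕ → EuclideanSpace ℝ (Fin d)}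
    (hz : Tendsto z atTop (𝓝 (extChartAt (𝓡 d) q q))) (hzS : ∀ k, z k ∈ chartImage q S)
    {b : ℕ → EuclideanSpace ℝ (Fin d) →L[ℝ] ℝ} {a : EuclideanSpace ℝ (Fin d) →L[ℝ] ℝ}
    (hb : Tendsto b atTop (𝓝 a)) (hmem : ∀ k, b k ∈ flatNormal (chartImage q S) (z k)) :
    a.comp (chartDeriv q q) ∈ limitingNormalCone S q := by
  have hx : Tendsto (fun k => (extChartAt (𝓡 d) q).symm (z k)) atTop (𝓝 q) := by
    have := (continuousAt_extChartAt_symm (I := 𝓡 d) q).tendsto.comp hz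
    rwa [extChartAt_to_inv] at this
  refine mem_limitingSubdiff_of_chart hx hb ?_ ?_
  · have h1 : ∀ x ∈ S, indicatorFn S x = 0 := fun x h => if_pos h
    rw [h1 q hq]
    exact tendsto_const_nhds.congr fun k => (h1 _ (hzS k).2).symm
  · exact Eventually.of_forall fun k => mem_frechetSubdiff_of_flatNormal (hzS k) (hmem k)

/-- Where `φ > 0`, subgradients have norm at least `Δ`, whereas these have norm at most a constant
times `‖b k‖`, which tends to zero. -/
theorem PhiRegularAt.limit_ne_zero [T2Space M] [IsManifold (𝓡 d) ∞ M]
    [RiemannianBundle (fun q : M => TangentSpace (𝓡 d) q)]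
    [IsContinuousRiemannianBundle (EuclideanSpace ℝ (Fin d))
      (fun q : M => TangentSpace (𝓡 d) q)] {φ : M → ℝ} {q : M}
    (hreg : PhiRegularAt (d := d) φ q) {z : ℕ → EuclideanSpace ℝ (Fin d)}
    (hz : Tendsto z atTop (𝓝 (extChartAt (𝓡 d) q q)))
    {b : ℕ → EuclideanSpace ℝ (Fin d) →L[ℝ] ℝ} (hb : Tendsto b atTop (𝓝 0))
    (hmem : ∀ k, b k ∈ flatSubdiff (φ ∘ (extChartAt (𝓡 d) q).symm) (z k)) :
    ∀ᶠ k in atTop, ¬0 < φ ((extChartAt (𝓡 d) q).symm (z k)) := by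
  obtain ⟨-, ⟨Δ, hΔ, hev⟩, -⟩ := hreg
  obtain ⟨K, hK, hKev⟩ := eventually_norm_comp_chartDeriv_le (d := d) q
  have hx : Tendsto (fun k => (extChartAt (𝓡 d) q).symm (z k)) atTop (𝓝 q) := by
    have := (continuousAt_extChartAt_symm (I := 𝓡 d) q).tendsto.comp hz
    rwa [extChartAt_to_inv] at this
  have hsmall : ∀ᶠ k in atTop, ‖b k‖ < Δ / K :=
    (tendsto_norm_zero.comp hb).eventually_lt_const (div_pos hΔ hK)
  filter_upwards [hx.eventually hev, hx.eventually hKev, hsmall,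
    hz (extChartAt_target_mem_nhds (I := 𝓡 d) q)] with k h1 h2 h3 h4 hpos
  have h5 := h1 hpos _ (frechetSubdiff_subset_limitingSubdiff _ _
    (mem_frechetSubdiff_of_flatSubdiff h4 (hmem k)))
  have h6 := h5.trans (h2 (b k))
  have h7 := (lt_div_iff₀ hK).1 h3
  linarith

end ChartImages

/-! ### Variations of a single control -/

section ControlCharts

variable {n : ℕ} {m : Fin n → ℕ} {U : Fin n → Type*} [∀ i, TopologicalSpace (U i)]
  [∀ i, ChartedSpace (EuclideanSpace ℝ (Fin (m i))) (U i)] [∀ i, IsManifold (𝓡 (m i)) ∞ (U i)]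

theorem mfderiv_extChartAt_symm_apply_single {u : ∀ i, U i} {i : Fin n}
    (v : TangentSpace (𝓡 (m i)) (u i)) (j : Fin n) :
    mfderiv 𝓘(ℝ, ∀ i, EuclideanSpace ℝ (Fin (m i))) (𝓡 (m j))
      (fun w : ∀ i, EuclideanSpace ℝ (Fin (m i)) => (extChartAt (𝓡 (m j)) (u j)).symm (w j))
      (fun i => extChartAt (𝓡 (m i)) (u i) (u i)) (Pi.single i (chartDeriv (u i) (u i) v)) =
      (Pi.single i v : ∀ i, EuclideanSpace ℝ (Fin (m i))) j := by
  set w₀ : ∀ i, EuclideanSpace ℝ (Fin (m i)) := fun i => extChartAt (𝓡 (m i)) (u i) (u i)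
  set δ : ∀ i, EuclideanSpace ℝ (Fin (m i)) := Pi.single i (chartDeriv (u i) (u i) v)
  have hsymm : MDifferentiableAt (𝓡 (m j)) (𝓡 (m j)) (extChartAt (𝓡 (m j)) (u j)).symm (w₀ j) :=
    ((contMDiffOn_extChartAt_symm (n := ∞) (u j)).contMDiffAt
      (extChartAt_target_mem_nhds (I := 𝓡 (m j)) (u j))).mdifferentiableAt (by simp)
  have hproj : HasFDerivAt (fun w : ∀ i, EuclideanSpace ℝ (Fin (m i)) => w j)
      (ContinuousLinearMap.proj (R := ℝ) (φ := fun i => EuclideanSpace ℝ (Fin (m i))) j) w₀ :=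
    hasFDerivAt_apply j w₀
  have h1 := mfderiv_comp w₀ (f := fun w : ∀ i, EuclideanSpace ℝ (Fin (m i)) => w j) hsymm
    hproj.differentiableAt.mdifferentiableAt
  rw [mfderiv_eq_fderiv, hproj.fderiv] at h1
  refine (DFunLike.congr_fun h1 δ).trans ?_
  rcases eq_or_ne j i with rfl | hj
  · have h3 := mfderiv_extChartAt_symm_chartDeriv (u j) v
    have h4 : δ j = chartDeriv (u j) (u j) v := Pi.single_eq_same _ _
    exact (congrArg (mfderiv (𝓡 (m j)) (𝓡 (m j)) (extChartAt (𝓡 (m j)) (u j)).symm (w₀ j))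
      h4).trans (h3.trans (Pi.single_eq_same (M := fun i => EuclideanSpace ℝ (Fin (m i))) j v).symm)
  · have h4 : δ j = 0 := Pi.single_eq_of_ne hj _
    exact ((congrArg (mfderiv (𝓡 (m j)) (𝓡 (m j)) (extChartAt (𝓡 (m j)) (u j)).symm (w₀ j))
      h4).trans (map_zero _)).trans (Pi.single_eq_of_ne
        (M := fun i => EuclideanSpace ℝ (Fin (m i))) hj v).symm

/-- The `i`-th component of `-T` is a limit of Fréchet normals to `C i`, hence a limiting normal,
and the Clarke tangent cone is its polar. -/
theorem nonneg_apply_single_of_flatNormal [∀ i, T2Space (U i)] {u : ∀ i, U i}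
    {C : ∀ i, Set (U i)} (hu : ∀ i, u i ∈ C i) {w : ℕ → ∀ i, EuclideanSpace ℝ (Fin (m i))}
    (hw : Tendsto w atTop (𝓝 fun i => extChartAt (𝓡 (m i)) (u i) (u i)))
    {ν : ℕ → (∀ i, EuclideanSpace ℝ (Fin (m i))) →L[ℝ] ℝ}
    {T : (∀ i, EuclideanSpace ℝ (Fin (m i))) →L[ℝ] ℝ}
    (hwν : ∀ k, w k ∈ univ.pi (fun i => chartImage (u i) (C i)) ∧
      ν k ∈ flatNormal (univ.pi fun i => chartImage (u i) (C i)) (w k))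
    (hν : Tendsto ν atTop (𝓝 (-T))) {i : Fin n} {v : TangentSpace (𝓡 (m i)) (u i)}
    (hv : v ∈ clarkeTangentCone (d := m i) (C i) (u i)) :
    0 ≤ T (Pi.single i (chartDeriv (u i) (u i) v)) := by
  have hwi := tendsto_pi_nhds.1 hw i
  have hνi := (((ContinuousLinearMap.compL ℝ (EuclideanSpace ℝ (Fin (m i)))
    (∀ i, EuclideanSpace ℝ (Fin (m i))) ℝ).flip
      (ContinuousLinearMap.single ℝ (fun i => EuclideanSpace ℝ (Fin (m i))) i)).continuous.tendsto
        (-T)).comp hν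
  have hN := hv _ (comp_chartDeriv_mem_limitingNormalCone (hu i) hwi
    (fun k => (hwν k).1 i trivial) hνi
    fun k => comp_single_mem_flatNormal (hwν k).1 (hwν k).2 i)
  have : -T (Pi.single i (chartDeriv (u i) (u i) v)) ≤ 0 := hN
  linarith

end ControlCharts

end DiscretePMP

/-! ### The maximum principle -/

theorem mainTheorem7 {d n : ℕ} {m : Fin n → ℕ}
    {Q : Type*} [TopologicalSpace Q] [T2Space Q]
    [ChartedSpace (EuclideanSpace ℝ (Fin d)) Q] [IsManifold (𝓡 d) ∞ Q]
    [RiemannianBundle (fun q : Q => TangentSpace (𝓡 d) q)]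
    [IsContinuousRiemannianBundle (EuclideanSpace ℝ (Fin d))
      (fun q : Q => TangentSpace (𝓡 d) q)]
    {U : Fin n → Type*} [∀ i, TopologicalSpace (U i)] [∀ i, T2Space (U i)]
    [∀ i, ChartedSpace (EuclideanSpace ℝ (Fin (m i))) (U i)]
    [∀ i, IsManifold (𝓡 (m i)) ∞ (U i)]
    (C : ∀ i, Set (U i)) (hC : ∀ i, ClarkeRegular (m i) (C i))
    (F : ∀ i, Q × U i → Q)
    (hF : ∀ i, ContMDiff ((𝓡 d).prod (𝓡 (m i))) (𝓡 d) 1 (F i))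
    (ℓ : Q → ℝ) (hℓ : ContMDiff (𝓡 d) 𝓘(ℝ, ℝ) 1 ℓ)
    (L : ∀ i, Q × U i → ℝ)
    (hL : ∀ i, ContMDiff ((𝓡 d).prod (𝓡 (m i))) 𝓘(ℝ, ℝ) 1 (L i))
    (φ : Fin (n + 1) → Q → ℝ) (hφ_lip : ∀ i, LocLipschitz d (φ i))
    (hφ_nonneg : ∀ i x, 0 ≤ φ i x)
    (q₀ : Q) (u : ∀ i, U i) (hu : u ∈ feasible F q₀ C φ)
    (hmin : ∀ c ∈ feasible F q₀ C φ, cost F q₀ ℓ L u ≤ cost F q₀ ℓ L c)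
    (hreg : ∀ i : Fin n, PhiRegularAt (d := d) (φ i.succ) (stateSeq F q₀ u i.succ)) :
    ∃ (lam κ : ℝ) (p : ∀ i : Fin (n + 1), Covector d (stateSeq F q₀ u i)),
      (lam = 0 ∨ lam = 1) ∧ 0 < κ ∧ (lam = 0 → κ = 1) ∧
      (∃ a ∈ limitingSubdiffReal (d := d) (φ (Fin.last n)) (stateSeq F q₀ u (Fin.last n)),
        -p (Fin.last n) = lam • mvfderiv (𝓡 d) ℓ (stateSeq F q₀ u (Fin.last n)) + κ • a) ∧
      (∀ i : Fin n,
        ∃ a ∈ limitingSubdiffReal (d := d) (φ i.castSucc) (stateSeq F q₀ u i.castSucc),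
          -p i.castSucc + (p i.succ).comp
              (mfderiv (𝓡 d) (𝓡 d) (fun q => F i (q, u i)) (stateSeq F q₀ u i.castSucc)) =
            lam • mvfderiv (𝓡 d) (fun q => L i (q, u i)) (stateSeq F q₀ u i.castSucc) +
              κ • a) ∧
      (∀ i : Fin n, ∀ v ∈ clarkeTangentCone (d := m i) (C i) (u i),
        0 ≤ lam * mvfderiv (𝓡 (m i)) (fun c => L i (stateSeq F q₀ u i.castSucc, c)) (u i) v -
          p i.succ (mfderiv (𝓡 (m i)) (𝓡 d)
            (fun c => F i (stateSeq F q₀ u i.castSucc, c)) (u i) v)) ∧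
      (lam = 1 ∨ ∃ i : Fin n, p i.succ ≠ 0) := by
  classical
  have hfeas0 : ∀ i, u i ∈ C i := hu.1
  have hfeas1 : ∀ j, φ j (stateSeq F q₀ u j) = 0 := hu.2
  let w₀ : ∀ i, EuclideanSpace ℝ (Fin (m i)) := fun i => extChartAt (𝓡 (m i)) (u i) (u i)
  let c : ∀ i, (∀ i, EuclideanSpace ℝ (Fin (m i))) → U i := fun i w =>
    (extChartAt (𝓡 (m i)) (u i)).symm (w i)
  have hcu : (fun i => c i w₀) = u := funext fun i => extChartAt_to_inv (I := 𝓡 (m i)) (u i)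
  have hsymm : ∀ i, ContMDiffAt (𝓡 (m i)) (𝓡 (m i)) 1 (extChartAt (𝓡 (m i)) (u i)).symm
      (w₀ i) := fun i =>
    ((contMDiffOn_extChartAt_symm (n := ∞) (u i)).contMDiffAt
      (extChartAt_target_mem_nhds (I := 𝓡 (m i)) (u i))).of_le (by simp)
  have hpr : ∀ i, ContDiff ℝ 1 fun w : ∀ i, EuclideanSpace ℝ (Fin (m i)) => w i := fun i =>
    (ContinuousLinearMap.proj (R := ℝ) (φ := fun i => EuclideanSpace ℝ (Fin (m i))) i).contDiff
  have hproj : ∀ i, ContMDiffAt 𝓘(ℝ, ∀ i, EuclideanSpace ℝ (Fin (m i))) (𝓡 (m i)) 1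
      (fun w : ∀ i, EuclideanSpace ℝ (Fin (m i)) => w i) w₀ := fun i =>
    (hpr i).contDiffAt.contMDiffAt
  have hc : ∀ i, ContMDiffAt 𝓘(ℝ, ∀ i, EuclideanSpace ℝ (Fin (m i))) (𝓡 (m i)) 1 (c i) w₀ :=
    fun i => ContMDiffAt.comp w₀ (hsymm i) (hproj i)
  have hS := fun j => contMDiffAt_stateSeq (q₀ := q₀) hF hc j
  have hS0 : ∀ j, stateSeq F q₀ (fun i => c i w₀) j = stateSeq F q₀ u j := fun j => by rw [hcu]
  let D : Set (∀ i, EuclideanSpace ℝ (Fin (m i))) := univ.pi fun i => chartImage (u i) (C i)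
  -- Only the states `j.succ` enter: the initial one does not depend on the controls.
  let y : Fin n → (∀ i, EuclideanSpace ℝ (Fin (m i))) → EuclideanSpace ℝ (Fin d) := fun j w =>
    extChartAt (𝓡 d) (stateSeq F q₀ u j.succ) (stateSeq F q₀ (fun i => c i w) j.succ)
  let ψ : Fin n → EuclideanSpace ℝ (Fin d) → ℝ := fun j =>
    φ j.succ ∘ (extChartAt (𝓡 d) (stateSeq F q₀ u j.succ)).symm
  have hy0 : ∀ j, y j w₀ =
      extChartAt (𝓡 d) (stateSeq F q₀ u j.succ) (stateSeq F q₀ u j.succ) := fun j =>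
    congrArg _ (hS0 j.succ)
  have hw₀D : w₀ ∈ D := fun i _ => ⟨mem_extChartAt_target (I := 𝓡 (m i)) (u i), by
    rw [mem_preimage, extChartAt_to_inv]; exact hfeas0 i⟩
  have hDc : ∃ r > 0, IsCompact (D ∩ Metric.closedBall w₀ r) := by
    have hev := eventually_all.2 fun i =>
      eventually_isCompact_chartImage_inter (d := m i) (u i) (hC i).1
    obtain ⟨r, hr, hr0⟩ := (hev.and self_mem_nhdsWithin).exists
    refine ⟨r, hr0, ?_⟩
    rw [closedBall_pi _ (le_of_lt hr0), ← pi_inter_distrib]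
    exact isCompact_univ_pi hr
  have hy : ∀ j, ContDiffAt ℝ 1 (y j) w₀ := fun j => by
    have h1 : ContMDiffAt (𝓡 d) (𝓡 d) 1 (extChartAt (𝓡 d) (stateSeq F q₀ u j.succ))
        (stateSeq F q₀ (fun i => c i w₀) j.succ) := by
      rw [hS0]
      exact (contMDiffAt_extChartAt (I := 𝓡 d) (n := ∞)).of_le (by simp)
    exact (ContMDiffAt.comp w₀ h1 (hS j.succ)).contDiffAt
  have hsrc : ∀ᶠ w in 𝓝 w₀, ∀ j : Fin n, stateSeq F q₀ (fun i => c i w) j.succ ∈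
      (extChartAt (𝓡 d) (stateSeq F q₀ u j.succ)).source := by
    refine eventually_all.2 fun j => (hS j.succ).continuousAt.eventually ?_
    beta_reduce
    rw [hS0]
    exact extChartAt_source_mem_nhds (I := 𝓡 d) _
  have hψy0 : ∀ j, ψ j (y j w₀) = 0 := fun j => by
    rw [hy0]
    exact (congrArg (φ j.succ) (extChartAt_to_inv (I := 𝓡 d) _)).trans (hfeas1 j.succ)
  -- Near `w₀` the states stay in their charts, so `ψ j (y j w)` is the true value of `φ j.succ`,
  -- and feasible `w` give feasible controls.
  have hminJ : ∀ᶠ w in 𝓝[D] w₀, (∀ j, ψ j (y j w) = 0) →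
      cost F q₀ ℓ L (fun i => c i w₀) ≤ cost F q₀ ℓ L (fun i => c i w) := by
    filter_upwards [nhdsWithin_le_nhds hsrc, self_mem_nhdsWithin] with w hw hwD hzero
    rw [hcu]
    refine hmin _ ⟨fun i => (hwD i trivial).2, fun j => ?_⟩
    refine Fin.cases (hfeas1 0) (fun i => ?_) j
    exact (congrArg (φ i.succ) ((extChartAt (𝓡 d) _).left_inv (hw i))).symm.trans (hzero i)
  -- The product carries the sup norm, whose square is not `C¹` in general; the sum of squares is.
  let sq : (∀ i, EuclideanSpace ℝ (Fin (m i))) → ℝ := fun w => ∑ i, ‖w i‖ ^ 2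
  have hsq : ContDiff ℝ 1 sq :=
    ContDiff.sum fun i _ => (hpr i).norm_sq ℝ
  have hsqpos : ∀ w, w ≠ 0 → 0 < sq w := by
    intro w hw
    obtain ⟨i, hi⟩ := Function.ne_iff.1 hw
    exact Finset.sum_pos' (fun i _ => by positivity)
      ⟨i, Finset.mem_univ i, pow_pos (norm_pos_iff.2 hi) 2⟩
  obtain ⟨lam, κ, hlam, hκ, hlk, w, ν, z, b, a, hwν, hwt, hνt, hzb, hbmem, hpos⟩ :=
    exists_limiting_multipliers hsq (by simp [sq]) hsqpos (fun j x => hφ_nonneg _ _) hw₀D hψy0 hDc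
      (contDiffAt_cost hF hℓ hL hc) hy
      (fun j => by
        rw [hy0]
        exact (hφ_lip j.succ).exists_lipschitzOnWith_extChartAt _) hminJ
  have hzt : ∀ j, Tendsto (fun k => z k j) atTop
      (𝓝 (extChartAt (𝓡 d) (stateSeq F q₀ u j.succ) (stateSeq F q₀ u j.succ))) := fun j =>
    hy0 j ▸ (hzb j).1
  -- At index `0` the subgradient is taken to be `0`, admissible because `φ 0` attains its minimum
  -- `0` at `q₀`.
  obtain ⟨ā, hā0, hās⟩ : ∃ ā : ∀ j, Covector d (stateSeq F q₀ u j), ā 0 = 0 ∧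
      ∀ i : Fin n, ā i.succ =
        (a i).comp (chartDeriv (stateSeq F q₀ u i.succ) (stateSeq F q₀ u i.succ)) :=
    ⟨Fin.cases 0 fun i =>
      (a i).comp (chartDeriv (stateSeq F q₀ u i.succ) (stateSeq F q₀ u i.succ)), rfl, fun _ => rfl⟩
  have hāmem : ∀ j, ā j ∈ limitingSubdiffReal (d := d) (φ j) (stateSeq F q₀ u j) := by
    intro j
    induction j using Fin.cases with
    | zero =>
      rw [hā0]
      refine frechetSubdiff_subset_limitingSubdiff _ _
        ⟨EReal.coe_ne_top _, fun _ => 0, contMDiff_const, ?_, ?_⟩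
      · unfold mvfderiv
        rw [mfderiv_const]
        rfl
      · refine Eventually.of_forall fun x => ?_
        beta_reduce
        rw [hfeas1 0]
        simpa using hφ_nonneg 0 x
    | succ i =>
      rw [hās]
      exact comp_chartDeriv_mem_limitingSubdiffReal (hφ_lip _).continuous (hzt i) (hzb i).2
        fun k => hbmem k i
  obtain ⟨p, hp1, hp2, hp3⟩ := exists_adjoint hF hℓ hL hc hcu lam κ hās
  refine ⟨lam, κ, p, hlam, hκ, hlk, ⟨_, hāmem _, hp1⟩, fun i => ⟨_, hāmem _, hp2 i⟩,
    fun i v hv => ?_, ?_⟩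
  · set T : (∀ i, EuclideanSpace ℝ (Fin (m i))) →L[ℝ] ℝ :=
      lam • fderiv ℝ (fun w => cost F q₀ ℓ L (fun i => c i w)) w₀ +
        κ • ∑ j, (a j).comp (fderiv ℝ (y j) w₀) with hT
    have hTδ := nonneg_apply_single_of_flatNormal hfeas0 hwt hwν hνt hv
    -- The variation moves only the `i`-th control, with velocity `v`, so the sum collapses to its
    -- `i`-th term.
    have h := hp3 _ _ fun j => mfderiv_extChartAt_symm_apply_single v j
    let f : ∀ j, EuclideanSpace ℝ (Fin (m j)) → ℝ := fun j x =>
      lam * mvfderiv (𝓡 (m j)) (fun z => L j (stateSeq F q₀ u j.castSucc, z)) (u j) x -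
        p j.succ (mfderiv (𝓡 (m j)) (𝓡 d) (fun z => F j (stateSeq F q₀ u j.castSucc, z)) (u j) x)
    have hf0 : ∀ j, f j 0 = 0 := fun j =>
      (congrArg₂ (fun s t => lam * s - t) (map_zero (mvfderiv (𝓡 (m j))
        (fun z => L j (stateSeq F q₀ u j.castSucc, z)) (u j)))
        ((congrArg (p j.succ) (map_zero _)).trans (map_zero _))).trans (by simp)
    have hsum : ∑ j, f j ((Pi.single i v : ∀ i, EuclideanSpace ℝ (Fin (m i))) j) = f i v :=
      (Finset.sum_eq_single i (fun j _ hj => (congrArg (f j) (Pi.single_eq_of_ne hj _)).trans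
        (hf0 j)) (fun hi => absurd (Finset.mem_univ i) hi)).trans
        (congrArg (f i) (Pi.single_eq_same _ _))
    refine (hTδ.trans_eq (Eq.trans ?_ h)).trans_eq hsum
    simp [hT, y]
  · rcases hlam with rfl | h1
    · right
      obtain rfl := hlk rfl
      by_contra! hp0
      have hp0' : ∀ j ≠ 0, p j = 0 := fun j hj => by
        obtain ⟨i, rfl⟩ := Fin.exists_succ_eq.2 hj
        exact hp0 i
      -- With zero cost multiplier and `κ = 1`, the terminal and adjoint relations express `ā j`
      -- through `p j` and its successor; for `j ≠ 0` the possibly nonzero `p 0` does not occur.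
      have hā : ∀ j ≠ 0, ā j = 0 := by
        intro j hj
        induction j using Fin.lastCases with
        | last =>
          rw [hp0' _ hj, neg_zero, zero_smul, zero_add, one_smul] at hp1
          exact hp1.symm
        | cast i =>
          have h := hp2 i
          rw [hp0' _ hj, hp0 i, neg_zero, zero_add, zero_smul, zero_add, one_smul] at h
          exact h.symm.trans (ContinuousLinearMap.zero_comp _)
      have ha : ∀ i, a i = 0 := by
        intro i
        ext v
        obtain ⟨v', rfl⟩ := chartDeriv_surjective (stateSeq F q₀ u i.succ) v
        exact DFunLike.congr_fun ((hās i).symm.trans (hā i.succ (Fin.succ_ne_zero i))) v'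
      -- Regularity eventually forbids `φ j.succ > 0` at the approximating points for all `j` at
      -- once, yet `hpos` provides such a `j` for every `k`.
      have hev := eventually_all.2 fun j =>
        (hreg j).limit_ne_zero (hzt j) (ha j ▸ (hzb j).2) fun k => hbmem k j
      obtain ⟨k, hk⟩ := hev.exists
      obtain ⟨j, hj⟩ := hpos rfl k
      exact hk j hj
    · exact Or.inl h1
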